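/- Let \(f:\mathbb{R}^p\to\mathbb{R}\) attain its global maximum at \(x^*\), and suppose that \(D_G^2:=-\nabla^2 f(x^*)\) is positive definite. Let \(D_V\) be a symmetric positive semidefinite \(p\times p\) matrix with \(D_V^2\le D_G^2\) such that the function \[ \ell(u)=f(x^*+u)+\tfrac12\|D_G u\|^2-\tfrac12\|D_V u\|^2,\qquad u\in\mathbb{R}^p, \] is concave. Define the effective dimension \(p_G=\operatorname{tr}(D_V^2D_G^{-2})\) and, for \(\mathtt{x}>0\) and \(0<\nu\le 3/4\), put \[ r_G=2\sqrt{p_G}+\sqrt{2\mathtt{x}},\qquad U=\{u\in\mathbb{R}^p:\ \|D_V u\|\le \nu^{-1}r_G\}. \] Let \(n>0\) and \(c_3\ge 0\). Assume that \((S_3)\) \(f\) is three times continuously differentiable near every point of \(x^*+U\), and \[ |\langle\nabla^3 f(x^*+su),u^{\otimes 3}\rangle|\le c_3\,n^{-1/2}\|D_V u\|^3\qquad\text{for all } u\in U,\ s\in[0,1], \] and that \(c_3\,r_G\,n^{-1/2}\le 3/4\). Then \(e^f\) is integrable, and the probability measure \(P_f\) with Lebesgue density proportional to \(e^{f}\)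 satisfies \[ \mathrm{TV}\bigl(P_f,\mathcal{N}(x^*,D_G^{-2})\bigr)=\sup_{A}\bigl|P_f(A)-\mathcal{N}(x^*,D_G^{-2})(A)\bigr|\le 2c_3\sqrt{\frac{(p_G+1)^3}{n}}+4e^{-\mathtt{x}}, \] the supremum being over all Borel sets \(A\subseteq\mathbb{R}^p\). If, moreover, for some \(c_4\ge 0\), \((S_4)\) \(f\) is four times continuously differentiable near every point of \(x^*+U\), and \[ |\langle\nabla^4 f(x^*+su),u^{\otimes 4}\rangle|\le c_4\,n^{-1}\|D_V u\|^4\qquad\text{for all } u\in U,\ s\in[0,1], \] then, over the centrally symmetric Borel sets (\(A=-A\)), with \(X\sim P_f\) and \(\gamma_G\sim\mathcal{N}(0,D_G^{-2})\), \[ \sup_{A=-A}\bigl|P_f(X-x^*\in A)-P(\gamma_G\in A)\bigr|\le \frac49\left\{\frac{c_3^2(p_G+2)^3}{n}+\frac{2c_4(p_G+1)^2}{n}\right\}+4e^{-\mathtt{x}}. \] -/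

import Mathlib

open MeasureTheory ProbabilityTheory

namespace LaplaceApprox

/-- The Hessian matrix `∇² f(x)` in the standard basis. -/
noncomputable def hessian {p : ℕ} (f : EuclideanSpace ℝ (Fin p) → ℝ)
    (x : EuclideanSpace ℝ (Fin p)) : Matrix (Fin p) (Fin p) ℝ :=
  Matrix.of fun i j =>
    iteratedFDeriv ℝ 2 f x ![EuclideanSpace.single i (1 : ℝ), EuclideanSpace.single j (1 : ℝ)]

/-- The matrix `D_G² = -∇² f(x)`. -/
noncomputable def DGsq {p : ℕ} (f : EuclideanSpace ℝ (Fin p) → ℝ)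
    (x : EuclideanSpace ℝ (Fin p)) : Matrix (Fin p) (Fin p) ℝ :=
  -hessian f x

/-- The Euclidean norm `‖D u‖` of a matrix applied to a vector. -/
noncomputable def normD {p : ℕ} (D : Matrix (Fin p) (Fin p) ℝ)
    (u : EuclideanSpace ℝ (Fin p)) : ℝ :=
  ‖Matrix.toEuclideanCLM (𝕜 := ℝ) D u‖

/-- The quadratic form `⟨M u, u⟩`; for `M = D_G²` it is `‖D_G u‖²`. -/
noncomputable def quadForm {p : ℕ} (M : Matrix (Fin p) (Fin p) ℝ)
    (u : EuclideanSpace ℝ (Fin p)) : ℝ :=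
  inner ℝ (Matrix.toEuclideanCLM (𝕜 := ℝ) M u) u

/-- `ℓ(u) = f(x + u) + ‖D_G u‖² / 2 - ‖D_V u‖² / 2`. -/
noncomputable def ell {p : ℕ} (f : EuclideanSpace ℝ (Fin p) → ℝ)
    (x : EuclideanSpace ℝ (Fin p)) (DV : Matrix (Fin p) (Fin p) ℝ)
    (u : EuclideanSpace ℝ (Fin p)) : ℝ :=
  f (x + u) + quadForm (DGsq f x) u / 2 - normD DV u ^ 2 / 2

/-- Condition `(C₀)`: `D_V` is symmetric positive semidefinite, `D_V² ≤ D_G²`, and `ℓ` is concave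
on the whole space. -/
structure CondC0 {p : ℕ} (f : EuclideanSpace ℝ (Fin p) → ℝ)
    (x : EuclideanSpace ℝ (Fin p)) (DV : Matrix (Fin p) (Fin p) ℝ) : Prop where
  posSemidef : DV.PosSemidef
  le_DGsq : (DGsq f x - DV * DV).PosSemidef
  concave : ConcaveOn ℝ Set.univ (ell f x DV)

/-- The effective dimension `p_G = tr(D_V² D_G⁻²)`. -/
noncomputable def effDim {p : ℕ} (f : EuclideanSpace ℝ (Fin p) → ℝ)
    (x : EuclideanSpace ℝ (Fin p)) (DV : Matrix (Fin p) (Fin p) ℝ) : ℝ :=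
  (DV * DV * (DGsq f x)⁻¹).trace

/-- The radius `r_G = 2 √p_G + √(2 t)` at the deviation level `t`. -/
noncomputable def radius {p : ℕ} (f : EuclideanSpace ℝ (Fin p) → ℝ)
    (x : EuclideanSpace ℝ (Fin p)) (DV : Matrix (Fin p) (Fin p) ℝ) (t : ℝ) : ℝ :=
  2 * √(effDim f x DV) + √(2 * t)

/-- The local set `U = {u : ‖D_V u‖ ≤ ν⁻¹ r_G}`. -/
def localSet {p : ℕ} (f : EuclideanSpace ℝ (Fin p) → ℝ)
    (x : EuclideanSpace ℝ (Fin p)) (DV : Matrix (Fin p) (Fin p) ℝ) (ν t : ℝ) :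
    Set (EuclideanSpace ℝ (Fin p)) :=
  {u | normD DV u ≤ ν⁻¹ * radius f x DV t}

/-- Condition `(S₃)` on a set `U` (at `x`): `f` is `C³` at the points of `x + U`, and
`|⟨∇³ f(x + s u), u^{⊗3}⟩| ≤ c₃ n^{-1/2} ‖D_V u‖³` for `u ∈ U`, `s ∈ [0, 1]`. -/
structure CondS3 {p : ℕ} (f : EuclideanSpace ℝ (Fin p) → ℝ)
    (x : EuclideanSpace ℝ (Fin p)) (DV : Matrix (Fin p) (Fin p) ℝ)
    (U : Set (EuclideanSpace ℝ (Fin p))) (n c₃ : ℝ) : Prop where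
  smooth : ∀ u ∈ U, ContDiffAt ℝ 3 f (x + u)
  bound : ∀ u ∈ U, ∀ s ∈ Set.Icc (0 : ℝ) 1,
    |iteratedFDeriv ℝ 3 f (x + s • u) (fun _ => u)| ≤ c₃ * (√n)⁻¹ * normD DV u ^ 3

/-- The fourth order part of condition `(S₄)` on a set `U` (at `x`): `f` is `C⁴` at the points of
`x + U`, and `|⟨∇⁴ f(x + s u), u^{⊗4}⟩| ≤ c₄ n^{-1} ‖D_V u‖⁴` for `u ∈ U`, `s ∈ [0, 1]`. -/
structure CondS4 {p : ℕ} (f : EuclideanSpace ℝ (Fin p) → ℝ)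
    (x : EuclideanSpace ℝ (Fin p)) (DV : Matrix (Fin p) (Fin p) ℝ)
    (U : Set (EuclideanSpace ℝ (Fin p))) (n c₄ : ℝ) : Prop where
  smooth : ∀ u ∈ U, ContDiffAt ℝ 4 f (x + u)
  bound : ∀ u ∈ U, ∀ s ∈ Set.Icc (0 : ℝ) 1,
    |iteratedFDeriv ℝ 4 f (x + s • u) (fun _ => u)| ≤ c₄ * n⁻¹ * normD DV u ^ 4

/-- The probability measure `P_f` with Lebesgue density proportional to `e^{f}`. -/
noncomputable def Pf {p : ℕ} (f : EuclideanSpace ℝ (Fin p) → ℝ) :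
    Measure (EuclideanSpace ℝ (Fin p)) :=
  (volume : Measure (EuclideanSpace ℝ (Fin p))).tilted f

/-- The supremum `sup_{A ∈ 𝒜} |μ(A) - ν(A)|` over a class of sets. -/
noncomputable def supDist {E : Type*} [MeasurableSpace E] (𝒜 : Set (Set E)) (μ ν : Measure E) : ℝ :=
  ⨆ A : 𝒜, |μ.real A - ν.real A|

/-- Total variation distance `sup_A |μ(A) - ν(A)|` over all measurable sets. -/
noncomputable def tvDist {E : Type*} [MeasurableSpace E] (μ ν : Measure E) : ℝ :=
  supDist {A : Set E | MeasurableSet A} μ ν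

/-- The centrally symmetric measurable sets. -/
def symmSets (E : Type*) [MeasurableSpace E] [Neg E] : Set (Set E) :=
  {A | MeasurableSet A ∧ ∀ u, u ∈ A ↔ -u ∈ A}

end LaplaceApprox

/-!
The proof transfers everything to the standard Gaussian measure `γ` on `ℝᵖ`. Put
`δ(u) = f(x* + u) - f(x*) + ‖D_G u‖² / 2` (`taylorRem`). In the coordinates `u = D_G⁻¹ w`
(`exists_whitening`) the Gaussian law becomes `γ` and `P_f` becomes `γ` tilted by `δ`
(`Pf_eq_map_tilted`), so the distance is governed by the density `F = exp δ` with respect to `γ`.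

Normalizing `F` is harmless: for every measurable `A`, the difference between the normalized
`F`-measure of `A` and `γ(A)` is at most the larger of `∫ (F - 1)₊ dγ` and `∫ (1 - F)₊ dγ`,
without a denominator (`abs_setIntegral_div_sub_le`). It remains to bound these two integrals, on
the ball `Z ≤ ρ` and off it, where `Z = ‖D_V u‖` and `ρ = (4 / 3) r_G ≤ r_G / ν`.

* The square `Z²` is a weighted sum of independent `χ²₁` variables with weights in `[0, 1]` adding
  up to `p_G` (`exists_isChiSqMixture`). Its exponential moments are explicit, and differentiating
  them bounds its tilted moments by those of a `χ²` law with `p_G` degrees of freedom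
  (`IsChiSqMixture.integral_pow_le`); the Chernoff bound gives the concentration
  `P(Z > √p_G + s) ≤ exp (-s² / 2)` (`IsChiSqMixture.measureReal_gt_le`).
* On the ball, Taylor's formula gives `|δ| ≤ τ Z³ / 6` with `τ = c₃ n^{-1/2}` and `τ ρ ≤ 1`
  (`CondS3.taylor`). For symmetric sets `F` may be replaced by its symmetrization, for which the odd
  part of `δ` enters only through its square, while the even part is at most `c₄ n⁻¹ Z⁴ / 24`
  (`CondS4.taylor`, `abs_exp_add_exp_half_sub_one_le`). The factor `exp (τ Z³ / 6)` is bounded for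
  `Z` of order `√p_G` and is dominated by the Gaussian tail beyond; here one may assume that the
  asserted bound is smaller than `1`, which makes `τ p_G^{3/2}` bounded
  (`IsChiSqMixture.exists_majorant_tv`, `IsChiSqMixture.exists_majorant_symm`).
* Off the ball, the concave function `ℓ` lies below its tangent along the ray at radius `ρ`, whence
  `δ ≤ Z² / 2 - ρ Z / 2 + ρ² / 6` (`taylorRem_le_of_concave`). The concentration of `Z` around
  `√p_G < ρ / 2` makes the exponential of the right-hand side integrable. If `4 exp (-t) < 1`, where
  `t` is the deviation level, its integral is at most `4 exp (-t)`; otherwise the asserted bounds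
  are at least `1` (`IsChiSqMixture.lintegral_tail_le`, `tail_constant_le`).
-/

namespace LaplaceApprox

/-! ### Weighted sums of chi-square variables -/

section ChiSq

variable {Ω ι : Type*} [MeasurableSpace Ω] [Fintype ι]

/-- `Y` is distributed under `μ` like `∑ᵢ λᵢ gᵢ²` with independent standard normal `gᵢ` and weights
`λᵢ ∈ [0, 1]`. This is recorded through the exponential moments
`E exp (θ Y / 2) = ∏ᵢ (1 - θ λᵢ)^(-1/2)`, `θ < 1`, the only property of such a law that is used. -/
structure IsChiSqMixture (μ : Measure Ω) (Y : Ω → ℝ) (lam : ι → ℝ) : Prop where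
  measurable : Measurable Y
  nonneg : ∀ ω, 0 ≤ Y ω
  weight_nonneg : ∀ i, 0 ≤ lam i
  weight_le_one : ∀ i, lam i ≤ 1
  integrable_exp : ∀ θ < 1, Integrable (fun ω => Real.exp (θ * (Y ω / 2))) μ
  integral_exp : ∀ θ < 1, ∫ ω, Real.exp (θ * (Y ω / 2)) ∂μ =
    Real.exp (-(1 / 2) * ∑ i, Real.log (1 - θ * lam i))

/-- The sums `∑ᵢ (λᵢ / (1 - θ λᵢ))ʲ`, in terms of which the derivatives of the exponential moments
of a chi-square mixture are expressed. -/
noncomputable def weightPowSum (lam : ι → ℝ) (j : ℕ) (θ : ℝ) : ℝ :=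
  ∑ i, (lam i / (1 - θ * lam i)) ^ j

lemma one_sub_mul_pos {θ l : ℝ} (hθ : θ < 1) (h0 : 0 ≤ l) (h1 : l ≤ 1) : 0 < 1 - θ * l := by
  nlinarith [mul_nonneg h0 (sub_nonneg.2 hθ.le)]

lemma hasDerivAt_weightPowSum {lam : ι → ℝ} (h0 : ∀ i, 0 ≤ lam i) (h1 : ∀ i, lam i ≤ 1) {θ : ℝ}
    (hθ : θ < 1) (j : ℕ) :
    HasDerivAt (weightPowSum lam j) (j * weightPowSum lam (j + 1) θ) θ := by
  unfold weightPowSum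
  rw [Finset.mul_sum]
  refine HasDerivAt.fun_sum fun i _ => ?_
  have hpos := one_sub_mul_pos hθ (h0 i) (h1 i)
  have h2 : HasDerivAt (fun θ => lam i / (1 - θ * lam i)) ((lam i / (1 - θ * lam i)) ^ 2) θ := by
    have h3 : HasDerivAt (fun θ => 1 - θ * lam i) (-(1 * lam i)) θ :=
      ((hasDerivAt_id θ).mul_const (lam i)).const_sub 1
    convert! (hasDerivAt_const θ (lam i)).fun_div h3 hpos.ne' using 1
    field_simp
    ring
  convert! h2.fun_pow j using 1
  rcases j with _ | j
  · simp
  · simp only [Nat.add_sub_cancel]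
    ring

lemma hasDerivAt_exp_sum_log {lam : ι → ℝ} (h0 : ∀ i, 0 ≤ lam i) (h1 : ∀ i, lam i ≤ 1) {θ : ℝ}
    (hθ : θ < 1) :
    HasDerivAt (fun θ => Real.exp (-(1 / 2) * ∑ i, Real.log (1 - θ * lam i)))
      (Real.exp (-(1 / 2) * ∑ i, Real.log (1 - θ * lam i)) * (weightPowSum lam 1 θ / 2)) θ := by
  refine HasDerivAt.exp ?_
  have : weightPowSum lam 1 θ / 2 = -(1 / 2) * ∑ i, (-(1 * lam i)) / (1 - θ * lam i) := by
    simp only [weightPowSum, pow_one, one_mul, neg_div, Finset.sum_neg_distrib]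
    ring
  rw [this]
  refine HasDerivAt.const_mul _ (HasDerivAt.fun_sum fun i _ => ?_)
  have h3 : HasDerivAt (fun θ => 1 - θ * lam i) (-(1 * lam i)) θ :=
    ((hasDerivAt_id θ).mul_const (lam i)).const_sub 1
  exact h3.log (one_sub_mul_pos hθ (h0 i) (h1 i)).ne'

lemma weightPowSum_nonneg {lam : ι → ℝ} (h0 : ∀ i, 0 ≤ lam i) (h1 : ∀ i, lam i ≤ 1) {θ : ℝ}
    (hθ : θ < 1) (j : ℕ) : 0 ≤ weightPowSum lam j θ :=
  Finset.sum_nonneg fun i _ =>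
    pow_nonneg (div_nonneg (h0 i) (one_sub_mul_pos hθ (h0 i) (h1 i)).le) j

lemma weightPowSum_le {lam : ι → ℝ} (h0 : ∀ i, 0 ≤ lam i) (h1 : ∀ i, lam i ≤ 1) {θ : ℝ}
    (hθ0 : 0 ≤ θ) (hθ : θ < 1) (j : ℕ) :
    weightPowSum lam (j + 1) θ ≤ (∑ i, lam i) / (1 - θ) ^ (j + 1) := by
  unfold weightPowSum
  rw [Finset.sum_div]
  refine Finset.sum_le_sum fun i _ => ?_
  have hpos : 0 < 1 - θ := by linarith
  have h2 : 1 - θ ≤ 1 - θ * lam i := by nlinarith [h1 i]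
  rw [div_pow]
  refine div_le_div₀ (h0 i) ?_ (by positivity) (pow_le_pow_left₀ hpos.le h2 _)
  exact pow_le_of_le_one (h0 i) (h1 i) (by simp)

namespace IsChiSqMixture

variable {μ : Measure Ω} {Y : Ω → ℝ} {lam : ι → ℝ}

lemma mem_interior (h : IsChiSqMixture μ Y lam) {θ : ℝ} (hθ : θ < 1) :
    θ ∈ interior (integrableExpSet (fun ω => Y ω / 2) μ) :=
  interior_mono (s := Set.Iio 1) (fun t ht => h.integrable_exp t ht) (by simpa using hθ)

lemma integrable_pow_mul_exp (h : IsChiSqMixture μ Y lam) {θ : ℝ} (hθ : θ < 1) (k : ℕ) :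
    Integrable (fun ω => Y ω ^ k * Real.exp (θ * (Y ω / 2))) μ := by
  have := (integrable_pow_mul_exp_of_mem_interior_integrableExpSet (h.mem_interior hθ) k).const_mul
    (2 ^ k)
  refine this.congr (Filter.Eventually.of_forall fun ω => ?_)
  simp only [div_pow]
  field_simp

lemma hasDerivAt (h : IsChiSqMixture μ Y lam) {θ : ℝ} (hθ : θ < 1) (k : ℕ) :
    HasDerivAt (fun θ => ∫ ω, Y ω ^ k * Real.exp (θ * (Y ω / 2)) ∂μ)
      ((∫ ω, Y ω ^ (k + 1) * Real.exp (θ * (Y ω / 2)) ∂μ) / 2) θ := by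
  have := (hasDerivAt_integral_pow_mul_exp_real (h.mem_interior hθ) k).const_mul (2 ^ k)
  convert! this using 1
  · ext t
    rw [← integral_const_mul]
    refine integral_congr_ae (Filter.Eventually.of_forall fun ω => ?_)
    simp only [div_pow]
    field_simp
  · rw [← integral_const_mul, ← integral_div]
    refine integral_congr_ae (Filter.Eventually.of_forall fun ω => ?_)
    simp only [div_pow]
    field_simp
    ring

/-- Differentiating a closed form for the `k`-th tilted moment gives the next one. -/
lemma integral_succ (h : IsChiSqMixture μ Y lam) {k : ℕ} {G : ℝ → ℝ} {G' θ : ℝ} (hθ : θ < 1)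
    (hG : ∀ t < 1, ∫ ω, Y ω ^ k * Real.exp (t * (Y ω / 2)) ∂μ = G t)
    (hG' : HasDerivAt G G' θ) :
    ∫ ω, Y ω ^ (k + 1) * Real.exp (θ * (Y ω / 2)) ∂μ = 2 * G' := by
  have h1 : HasDerivAt G ((∫ ω, Y ω ^ (k + 1) * Real.exp (θ * (Y ω / 2)) ∂μ) / 2) θ :=
    (h.hasDerivAt hθ k).congr_of_eventuallyEq
      (Filter.eventually_of_mem (Iio_mem_nhds hθ) fun t ht => (hG t ht).symm)
  linarith [h1.unique hG']

lemma integral_one (h : IsChiSqMixture μ Y lam) {θ : ℝ} (hθ : θ < 1) :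
    ∫ ω, Y ω ^ 1 * Real.exp (θ * (Y ω / 2)) ∂μ =
      Real.exp (-(1 / 2) * ∑ i, Real.log (1 - θ * lam i)) * weightPowSum lam 1 θ := by
  rw [h.integral_succ (k := 0) hθ (fun t ht => by simpa using h.integral_exp t ht)
    (hasDerivAt_exp_sum_log h.weight_nonneg h.weight_le_one hθ)]
  ring

lemma integral_two (h : IsChiSqMixture μ Y lam) {θ : ℝ} (hθ : θ < 1) :
    ∫ ω, Y ω ^ 2 * Real.exp (θ * (Y ω / 2)) ∂μ =
      Real.exp (-(1 / 2) * ∑ i, Real.log (1 - θ * lam i)) *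
        (weightPowSum lam 1 θ ^ 2 + 2 * weightPowSum lam 2 θ) := by
  have hd := fun j => hasDerivAt_weightPowSum h.weight_nonneg h.weight_le_one hθ j
  rw [h.integral_succ (k := 1) hθ (fun t ht => h.integral_one ht)
    ((hasDerivAt_exp_sum_log h.weight_nonneg h.weight_le_one hθ).fun_mul (hd 1))]
  push_cast
  ring

lemma integral_three (h : IsChiSqMixture μ Y lam) {θ : ℝ} (hθ : θ < 1) :
    ∫ ω, Y ω ^ 3 * Real.exp (θ * (Y ω / 2)) ∂μ =
      Real.exp (-(1 / 2) * ∑ i, Real.log (1 - θ * lam i)) *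
        (weightPowSum lam 1 θ ^ 3 + 6 * weightPowSum lam 1 θ * weightPowSum lam 2 θ +
          8 * weightPowSum lam 3 θ) := by
  have hd := fun j => hasDerivAt_weightPowSum h.weight_nonneg h.weight_le_one hθ j
  rw [h.integral_succ (k := 2) hθ (fun t ht => h.integral_two ht)
    ((hasDerivAt_exp_sum_log h.weight_nonneg h.weight_le_one hθ).fun_mul
      (((hd 1).fun_pow 2).fun_add ((hd 2).const_mul 2)))]
  push_cast
  ring

/-- By concavity of the logarithm, `E exp (θ Y / 2) ≤ (1 - θ)^(-p / 2)` with `p = ∑ᵢ λᵢ`: the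
mixture is no worse than a chi-square law with `p` degrees of freedom. -/
lemma exp_sum_log_le (h : IsChiSqMixture μ Y lam) {θ : ℝ} (hθ : θ < 1) :
    Real.exp (-(1 / 2) * ∑ i, Real.log (1 - θ * lam i)) ≤
      Real.exp (-(1 / 2) * (∑ i, lam i) * Real.log (1 - θ)) := by
  have hpos : 0 < 1 - θ := by linarith
  refine Real.exp_le_exp.2 ?_
  have : (∑ i, lam i) * Real.log (1 - θ) ≤ ∑ i, Real.log (1 - θ * lam i) := by
    rw [Finset.sum_mul]
    refine Finset.sum_le_sum fun i _ => ?_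
    have hc := strictConcaveOn_log_Ioi.concaveOn.2 (Set.mem_Ioi.2 one_pos) (Set.mem_Ioi.2 hpos)
      (sub_nonneg.2 (h.weight_le_one i)) (h.weight_nonneg i) (by ring)
    simp only [smul_eq_mul, Real.log_one, mul_zero, zero_add] at hc
    refine hc.trans (le_of_eq ?_)
    congr 1
    ring
  linarith

/-- Tilted moments of a chi-square mixture, compared with those of a chi-square law with
`p = ∑ᵢ λᵢ` degrees of freedom. -/
lemma integral_pow_le (h : IsChiSqMixture μ Y lam) {θ : ℝ} (hθ0 : 0 ≤ θ) (hθ : θ < 1) {p : ℝ}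
    (hp : ∑ i, lam i = p) :
    (∫ ω, Y ω ^ 1 * Real.exp (θ * (Y ω / 2)) ∂μ ≤
      Real.exp (-(1 / 2) * p * Real.log (1 - θ)) * (p / (1 - θ))) ∧
    (∫ ω, Y ω ^ 2 * Real.exp (θ * (Y ω / 2)) ∂μ ≤
      Real.exp (-(1 / 2) * p * Real.log (1 - θ)) * (p * (p + 2) / (1 - θ) ^ 2)) ∧
    (∫ ω, Y ω ^ 3 * Real.exp (θ * (Y ω / 2)) ∂μ ≤
      Real.exp (-(1 / 2) * p * Real.log (1 - θ)) * (p * (p + 2) * (p + 4) / (1 - θ) ^ 3)) := by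
  have hle := h.exp_sum_log_le hθ
  rw [h.integral_one hθ, h.integral_two hθ, h.integral_three hθ]
  rw [hp] at hle
  have hs := fun j => weightPowSum_nonneg h.weight_nonneg h.weight_le_one hθ j
  have hb := fun j => weightPowSum_le h.weight_nonneg h.weight_le_one hθ0 hθ j
  have h1 := hb 0
  have h2 := hb 1
  have h3 := hb 2
  simp only [zero_add, Nat.reduceAdd, pow_one, hp] at h1 h2 h3
  have hpos : 0 < 1 - θ := by linarith
  have hp0 : 0 ≤ p := hp ▸ Finset.sum_nonneg fun i _ => h.weight_nonneg i
  have s1 := hs 1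
  have s2 := hs 2
  have s3 := hs 3
  refine ⟨?_, ?_, ?_⟩
  · exact mul_le_mul hle h1 s1 (Real.exp_pos _).le
  · refine mul_le_mul hle ?_ (by positivity) (Real.exp_pos _).le
    calc _ ≤ (p / (1 - θ)) ^ 2 + 2 * (p / (1 - θ) ^ 2) := by gcongr
      _ = _ := by field_simp
  · refine mul_le_mul hle ?_ (by positivity) (Real.exp_pos _).le
    calc _ ≤ (p / (1 - θ)) ^ 3 + 6 * (p / (1 - θ)) * (p / (1 - θ) ^ 2) + 8 * (p / (1 - θ) ^ 3) := by
          gcongr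
      _ = _ := by field_simp; ring

/-- Gaussian concentration of `√Y` around `√p`, by the Chernoff bound with `1 - θ = p / (√p + s)²`
(and with `θ → 1` when `p = 0`). -/
lemma measureReal_gt_le [IsProbabilityMeasure μ] (h : IsChiSqMixture μ Y lam) {p s : ℝ}
    (hp : ∑ i, lam i = p) (hs : 0 ≤ s) :
    μ.real {ω | √p + s < √(Y ω)} ≤ Real.exp (-s ^ 2 / 2) := by
  have hp0 : 0 ≤ p := hp ▸ Finset.sum_nonneg fun i _ => h.weight_nonneg i
  -- the Chernoff bound at a fixed `θ`
  have key : ∀ θ, 0 ≤ θ → θ < 1 → μ.real {ω | √p + s < √(Y ω)} ≤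
      Real.exp (-(θ * ((√p + s) ^ 2 / 2))) * Real.exp (-(1 / 2) * p * Real.log (1 - θ)) := by
    intro θ hθ0 hθ
    have h1 : μ.real {ω | √p + s < √(Y ω)} ≤ μ.real {ω | (√p + s) ^ 2 / 2 ≤ Y ω / 2} := by
      refine measureReal_mono fun ω hω => ?_
      have : (√p + s) ^ 2 ≤ √(Y ω) ^ 2 :=
        pow_le_pow_left₀ (by positivity) (le_of_lt hω) 2
      rw [Real.sq_sqrt (h.nonneg ω)] at this
      simp only [Set.mem_ofPred_eq]
      linarith
    refine h1.trans ((measure_ge_le_exp_mul_mgf _ hθ0 (h.integrable_exp θ hθ)).trans ?_)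
    rw [neg_mul]
    refine mul_le_mul_of_nonneg_left ?_ (Real.exp_pos _).le
    rw [mgf, h.integral_exp θ hθ, ← hp]
    exact h.exp_sum_log_le hθ
  rcases hp0.eq_or_lt with rfl | hp0
  · have hlim : Filter.Tendsto (fun θ : ℝ => Real.exp (-(θ * (s ^ 2 / 2)))) (nhdsWithin 1 (Set.Iio 1))
        (nhds (Real.exp (-s ^ 2 / 2))) := by
      have : Continuous fun θ : ℝ => Real.exp (-(θ * (s ^ 2 / 2))) := by fun_prop
      convert! (this.tendsto 1).mono_left nhdsWithin_le_nhds using 2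
      ring_nf
    refine ge_of_tendsto hlim ?_
    have h01 : Set.Ico (0 : ℝ) 1 ∈ nhdsWithin (1 : ℝ) (Set.Iio 1) :=
      Ico_mem_nhdsLT one_pos
    filter_upwards [h01] with θ hθ
    simpa using key θ hθ.1 hθ.2
  · have ha : 0 < √p := Real.sqrt_pos.2 hp0
    have hsq : √p ^ 2 = p := Real.sq_sqrt hp0.le
    set a := √p with ha_def
    have has : 0 < a + s := by linarith
    have hle1 : p / (a + s) ^ 2 ≤ 1 := by
      rw [div_le_one (by positivity), ← hsq]
      exact pow_le_pow_left₀ ha.le (by linarith) 2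
    refine (key (1 - p / (a + s) ^ 2) (by linarith) (by
      have : 0 < p / (a + s) ^ 2 := by positivity
      linarith)).trans ?_
    rw [← Real.exp_add]
    refine Real.exp_le_exp.2 ?_
    rw [sub_sub_cancel, ← hsq, ← div_pow, Real.log_pow]
    have hlog : -Real.log (a / (a + s)) ≤ s / a := by
      rw [← Real.log_inv, inv_div]
      refine (Real.log_le_sub_one_of_pos (by positivity)).trans (le_of_eq ?_)
      field_simp
      ring
    have h2 : (1 - (a / (a + s)) ^ 2) * ((a + s) ^ 2 / 2) = a * s + s ^ 2 / 2 := by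
      field_simp
      ring
    rw [h2]
    have h3 : a ^ 2 * -Real.log (a / (a + s)) ≤ a ^ 2 * (s / a) :=
      mul_le_mul_of_nonneg_left hlog (by positivity)
    have h4 : a ^ 2 * (s / a) = a * s := by field_simp
    push_cast
    linarith

end IsChiSqMixture

end ChiSq

/-! ### The standard Gaussian measure and quadratic forms -/

section Gaussian

lemma integrable_exp_sq_gaussianReal {c : ℝ} (hc : c < 1) :
    Integrable (fun x : ℝ => Real.exp (c * x ^ 2 / 2)) (gaussianReal 0 1) := by
  rw [gaussianReal_of_var_ne_zero 0 one_ne_zero, integrable_withDensity_iff (by fun_prop)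
    (Filter.Eventually.of_forall fun x => gaussianPDF_lt_top)]
  have := (integrable_exp_neg_mul_sq (b := (1 - c) / 2) (by linarith)).const_mul (√(2 * Real.pi))⁻¹
  refine this.congr (Filter.Eventually.of_forall fun x => ?_)
  simp only [toReal_gaussianPDF, gaussianPDFReal, NNReal.coe_one, mul_one, sub_zero]
  rw [mul_left_comm, ← Real.exp_add]
  ring_nf

lemma integral_exp_sq_gaussianReal {c : ℝ} (hc : c < 1) :
    ∫ x : ℝ, Real.exp (c * x ^ 2 / 2) ∂(gaussianReal 0 1) =
      Real.exp (-(1 / 2) * Real.log (1 - c)) := by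
  have hpos : 0 < 1 - c := by linarith
  rw [integral_gaussianReal_eq_integral_smul one_ne_zero]
  have : ∀ x : ℝ, gaussianPDFReal 0 1 x • Real.exp (c * x ^ 2 / 2) =
      (√(2 * Real.pi))⁻¹ * Real.exp (-((1 - c) / 2) * x ^ 2) := by
    intro x
    simp only [gaussianPDFReal, NNReal.coe_one, mul_one, sub_zero, smul_eq_mul]
    rw [mul_assoc, ← Real.exp_add]
    ring_nf
  simp_rw [this]
  rw [integral_const_mul, integral_gaussian]
  have h1 : Real.pi / ((1 - c) / 2) = 2 * Real.pi / (1 - c) := by field_simp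
  rw [h1, Real.sqrt_div (by positivity), mul_comm (-(1 / 2) : ℝ), Real.exp_mul, Real.exp_log hpos,
    Real.rpow_neg hpos.le, ← Real.sqrt_eq_rpow]
  have : √(2 * Real.pi) ≠ 0 := by positivity
  field_simp

variable {d : ℕ}

/-- For a contraction `B`, the square norm `‖B γ‖²` of a standard Gaussian vector is a chi-square
mixture whose weights sum to `tr (Bᵀ B)`: diagonalize `Bᵀ B` in an orthonormal basis. -/
lemma exists_isChiSqMixture (B : Matrix (Fin d) (Fin d) ℝ)
    (hB : ∀ w, ‖Matrix.toEuclideanCLM (𝕜 := ℝ) B w‖ ≤ ‖w‖) :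
    ∃ lam : Fin d → ℝ, ∑ i, lam i = (B.transpose * B).trace ∧
      IsChiSqMixture (stdGaussian (EuclideanSpace ℝ (Fin d)))
        (fun w => ‖Matrix.toEuclideanCLM (𝕜 := ℝ) B w‖ ^ 2) lam := by
  have hM : (B.transpose * B).IsHermitian := by
    simpa using Matrix.isHermitian_conjTranspose_mul_self B
  set b := hM.eigenvectorBasis with hb
  have hinner : ∀ v w, inner ℝ (Matrix.toEuclideanCLM (𝕜 := ℝ) B v)
      (Matrix.toEuclideanCLM (𝕜 := ℝ) B w) =
      inner ℝ v (Matrix.toEuclideanCLM (𝕜 := ℝ) (B.transpose * B) w) := by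
    intro v w
    have h1 : Matrix.toEuclideanCLM (𝕜 := ℝ) B.transpose =
        ContinuousLinearMap.adjoint (Matrix.toEuclideanCLM (𝕜 := ℝ) B) := by
      have := map_star (Matrix.toEuclideanCLM (𝕜 := ℝ) (n := Fin d)) B
      simpa [Matrix.star_eq_conjTranspose, ContinuousLinearMap.star_eq_adjoint] using this
    rw [map_mul, h1, mul_apply_eq_comp, ContinuousLinearMap.adjoint_inner_right]
  have heig : ∀ i, Matrix.toEuclideanCLM (𝕜 := ℝ) (B.transpose * B) (b i) =
      hM.eigenvalues i • b i := by
    intro i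
    have := hM.mulVec_eigenvectorBasis i
    ext j
    simpa using congrFun this j
  have hlam : ∀ i, hM.eigenvalues i = ‖Matrix.toEuclideanCLM (𝕜 := ℝ) B (b i)‖ ^ 2 := by
    intro i
    rw [← real_inner_self_eq_norm_sq, hinner, heig, inner_smul_right, real_inner_self_eq_norm_sq,
      b.norm_eq_one]
    simp
  have hsum : ∀ x : Fin d → ℝ, ‖Matrix.toEuclideanCLM (𝕜 := ℝ) B (∑ i, x i • b i)‖ ^ 2 =
      ∑ i, hM.eigenvalues i * x i ^ 2 := by
    intro x
    rw [← real_inner_self_eq_norm_sq, hinner, map_sum]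
    simp_rw [map_smul, heig, smul_smul]
    rw [b.orthonormal.inner_sum]
    refine Finset.sum_congr rfl fun i _ => ?_
    simp only [conj_trivial]
    ring
  have hmeas : Measurable fun x : Fin d → ℝ => ∑ i, x i • b i := by fun_prop
  have hcont : Continuous fun w => ‖Matrix.toEuclideanCLM (𝕜 := ℝ) B w‖ ^ 2 := by fun_prop
  have hl0 : ∀ i, 0 ≤ hM.eigenvalues i := fun i => by rw [hlam]; positivity
  have hl1 : ∀ i, hM.eigenvalues i ≤ 1 := fun i => by
    rw [hlam]
    have := hB (b i)
    rw [b.norm_eq_one] at this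
    exact pow_le_one₀ (norm_nonneg _) this
  have hexp : ∀ θ : ℝ, ∀ x : Fin d → ℝ, Real.exp (θ * (‖Matrix.toEuclideanCLM (𝕜 := ℝ) B
      (∑ i, x i • b i)‖ ^ 2 / 2)) = ∏ i, Real.exp (θ * hM.eigenvalues i * x i ^ 2 / 2) := by
    intro θ x
    rw [hsum, ← Real.exp_sum, Finset.sum_div, Finset.mul_sum]
    congr 1
    exact Finset.sum_congr rfl fun i _ => by ring
  have hlt : ∀ θ : ℝ, θ < 1 → ∀ i, θ * hM.eigenvalues i < 1 := fun θ hθ i => by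
    linarith [one_sub_mul_pos hθ (hl0 i) (hl1 i)]
  refine ⟨hM.eigenvalues, ?_, hcont.measurable, fun w => by positivity, hl0, hl1, ?_, ?_⟩
  · rw [hM.trace_eq_sum_eigenvalues]
    simp
  · intro θ hθ
    rw [stdGaussian_eq_map_pi_orthonormalBasis b, integrable_map_measure
      (Continuous.aestronglyMeasurable (by fun_prop)) hmeas.aemeasurable]
    simp only [Function.comp_def, hexp]
    exact Integrable.fintype_prod (f := fun i x => Real.exp (θ * hM.eigenvalues i * x ^ 2 / 2))
      fun i => integrable_exp_sq_gaussianReal (hlt θ hθ i)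
  · intro θ hθ
    rw [stdGaussian_eq_map_pi_orthonormalBasis b, integral_map hmeas.aemeasurable
      (Continuous.aestronglyMeasurable (by fun_prop))]
    simp only [hexp]
    rw [integral_fintype_prod_eq_prod
      (f := fun i x => Real.exp (θ * hM.eigenvalues i * x ^ 2 / 2)), Finset.mul_sum, Real.exp_sum]
    exact Finset.prod_congr rfl fun i _ => integral_exp_sq_gaussianReal (hlt θ hθ i)

lemma integrable_exp_neg_norm_sq :
    Integrable fun w : EuclideanSpace ℝ (Fin d) => Real.exp (-(‖w‖ ^ 2 / 2)) := by
  have h := (GaussianFourier.integrable_cexp_neg_mul_sq_norm_add (V := EuclideanSpace ℝ (Fin d))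
    (b := (1 / 2 : ℂ)) (by norm_num) 0 0).re
  refine h.congr (Filter.Eventually.of_forall fun w => ?_)
  have : (-(1 / 2 : ℂ) * (‖w‖ : ℂ) ^ 2 + 0 * ((inner ℝ (0 : EuclideanSpace ℝ (Fin d)) w : ℝ) : ℂ)) =
      ((-(‖w‖ ^ 2 / 2) : ℝ) : ℂ) := by
    push_cast
    ring
  simp only [this, RCLike.re_eq_complex_re, Complex.exp_ofReal_re]

/-- The standard Gaussian measure has Lebesgue density proportional to `exp (-‖w‖² / 2)`; both
measures have the same characteristic function. -/
lemma stdGaussian_eq_tilted :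
    stdGaussian (EuclideanSpace ℝ (Fin d)) = volume.tilted fun w => -(‖w‖ ^ 2 / 2) := by
  have := isProbabilityMeasure_tilted (integrable_exp_neg_norm_sq (d := d))
  refine Measure.ext_of_charFun ?_
  ext t
  rw [charFun_stdGaussian, charFun_apply, integral_tilted]
  have hI : ∫ w : EuclideanSpace ℝ (Fin d), Real.exp (-(‖w‖ ^ 2 / 2)) =
      (2 * Real.pi) ^ (d / 2 : ℝ) := by
    have := GaussianFourier.integral_rexp_neg_mul_sq_norm (V := EuclideanSpace ℝ (Fin d))
      (b := 1 / 2) (by norm_num)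
    rw [finrank_euclideanSpace_fin, show Real.pi / (1 / 2) = 2 * Real.pi by ring] at this
    rw [← this]
    congr 1
    ext w
    ring_nf
  rw [hI]
  have h1 : ∀ w : EuclideanSpace ℝ (Fin d),
      (Real.exp (-(‖w‖ ^ 2 / 2)) / (2 * Real.pi) ^ (d / 2 : ℝ)) •
        Complex.exp ((inner ℝ w t : ℝ) * Complex.I) =
      (((2 * Real.pi) ^ (d / 2 : ℝ) : ℝ) : ℂ)⁻¹ *
        Complex.exp (-(1 / 2 : ℂ) * (‖w‖ : ℂ) ^ 2 + Complex.I * (inner ℝ t w : ℝ)) := by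
    intro w
    rw [Complex.real_smul, Complex.ofReal_div, div_eq_inv_mul, mul_assoc, Complex.ofReal_exp,
      ← Complex.exp_add, real_inner_comm]
    congr 2
    push_cast
    ring
  simp_rw [h1]
  rw [integral_const_mul, GaussianFourier.integral_cexp_neg_mul_sq_norm_add (by norm_num),
    finrank_euclideanSpace_fin]
  have h2 : ((Real.pi : ℂ) / (1 / 2)) ^ ((d : ℂ) / 2) = (((2 * Real.pi) ^ (d / 2 : ℝ) : ℝ) : ℂ) := by
    rw [Complex.ofReal_cpow (by positivity)]
    push_cast
    congr 1
    ring
  rw [h2, ← mul_assoc, inv_mul_cancel₀, one_mul, Complex.I_sq]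
  · congr 1
    ring
  · rw [Ne, Complex.ofReal_eq_zero]
    positivity

/-- Tilting the image of a measure under a measurable equivalence. -/
lemma tilted_map_equiv {α β : Type*} [MeasurableSpace α] [MeasurableSpace β] (μ : Measure α)
    (e : α ≃ᵐ β) (f : β → ℝ) : (μ.map e).tilted f = (μ.tilted (f ∘ e)).map e := by
  ext s hs
  rw [tilted_apply' _ _ hs, Measure.map_apply e.measurable hs,
    tilted_apply' _ _ (e.measurable hs), e.measurableEmbedding.restrict_map, lintegral_map_equiv,
    integral_map_equiv]
  rfl

lemma tilted_smul_measure {α : Type*} [MeasurableSpace α] (μ : Measure α) (f : α → ℝ) {c : ENNReal}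
    (hc : c ≠ 0) (hc' : c ≠ ⊤) : (c • μ).tilted f = μ.tilted f := by
  ext s hs
  rw [tilted_apply' _ _ hs, tilted_apply' _ _ hs, Measure.restrict_smul, lintegral_smul_measure,
    integral_smul_measure, smul_eq_mul, smul_eq_mul, ← lintegral_const_mul' _ _ hc']
  refine lintegral_congr fun a => ?_
  have hcr : 0 < c.toReal := ENNReal.toReal_pos hc hc'
  conv_lhs => rw [← ENNReal.ofReal_toReal hc', ENNReal.toReal_ofReal hcr.le]
  rw [← ENNReal.ofReal_mul hcr.le, ← mul_div_assoc, mul_div_mul_left _ _ hcr.ne']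

end Gaussian

/-! ### Comparison of a normalized density with the reference measure -/

section Comparison

variable {Ω : Type*} [MeasurableSpace Ω] {μ : Measure Ω} [IsProbabilityMeasure μ]

/-- Normalizing a density `F` does not require control of the normalizing constant `∫ F`: if
`∫ F ≥ 1` the positive part of `F / ∫ F - 1` is at most that of `F - 1`, and if `∫ F ≤ 1` the same
holds for the negative parts, while both parts of `F / ∫ F - 1` have the same integral. -/
lemma abs_setIntegral_div_sub_le {F h₁ h₂ : Ω → ℝ} {C : ℝ} (hF : Integrable F μ)
    (hF0 : ∀ ω, 0 ≤ F ω) (hpos : 0 < ∫ ω, F ω ∂μ) (hi₁ : Integrable h₁ μ) (hi₂ : Integrable h₂ μ)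
    (h₁0 : ∀ ω, 0 ≤ h₁ ω) (h₂0 : ∀ ω, 0 ≤ h₂ ω) (hF₁ : ∀ ω, F ω - 1 ≤ h₁ ω)
    (hF₂ : ∀ ω, 1 - F ω ≤ h₂ ω) (hC₁ : ∫ ω, h₁ ω ∂μ ≤ C) (hC₂ : ∫ ω, h₂ ω ∂μ ≤ C) {A : Set Ω}
    (hA : MeasurableSet A) :
    |(∫ ω in A, F ω ∂μ) / (∫ ω, F ω ∂μ) - μ.real A| ≤ C := by
  set Z := ∫ ω, F ω ∂μ with hZ
  set g : Ω → ℝ := fun ω => F ω / Z - 1 with hg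
  have hgi : Integrable g μ := (hF.div_const Z).sub (integrable_const 1)
  have hset : ∀ S, ∫ ω in S, g ω ∂μ = (∫ ω in S, F ω ∂μ) / Z - μ.real S := by
    intro S
    rw [hg, integral_sub (hF.div_const Z).integrableOn (integrable_const 1).integrableOn,
      integral_div]
    simp
  have hsum : ∫ ω in A, g ω ∂μ + ∫ ω in Aᶜ, g ω ∂μ = 0 := by
    rw [integral_add_compl hA hgi, ← setIntegral_univ, hset, setIntegral_univ, ← hZ, div_self hpos.ne']
    simp
  have up : ∀ (h : Ω → ℝ) (k : Ω → ℝ) (S : Set Ω), Integrable h μ → Integrable k μ →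
      (∀ ω, 0 ≤ h ω) → (∀ ω, k ω ≤ h ω) → ∫ ω, h ω ∂μ ≤ C → ∫ ω in S, k ω ∂μ ≤ C := by
    intro h k S hi ki h0 hk hC
    refine le_trans (b := ∫ ω in S, h ω ∂μ) ?_
      ((setIntegral_le_integral hi (Filter.Eventually.of_forall h0)).trans hC)
    exact integral_mono ki.integrableOn hi.integrableOn hk
  rw [← hset, abs_le]
  rcases le_total 1 Z with h1 | h1
  · have hle : ∀ ω, g ω ≤ h₁ ω := fun ω =>
      le_trans (sub_le_sub_right (div_le_self (hF0 ω) h1) 1) (hF₁ ω)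
    have a := up h₁ g A hi₁ hgi h₁0 hle hC₁
    have b := up h₁ g Aᶜ hi₁ hgi h₁0 hle hC₁
    constructor <;> linarith
  · have hle : ∀ ω, -g ω ≤ h₂ ω := fun ω => by
      have : F ω ≤ F ω / Z := by
        rw [le_div_iff₀ hpos]
        exact mul_le_of_le_one_right (hF0 ω) h1
      have := hF₂ ω
      simp only [hg]
      linarith
    have a := up h₂ (fun ω => -g ω) A hi₂ hgi.neg h₂0 hle hC₂
    have b := up h₂ (fun ω => -g ω) Aᶜ hi₂ hgi.neg h₂0 hle hC₂
    rw [integral_neg] at a b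
    constructor <;> linarith

end Comparison

/-! ### The tail integral -/

section Tail

lemma integral_linear_mul_exp_neg {m k : ℝ} (hm : 0 ≤ m) (hk : 0 < k) :
    IntegrableOn (fun s => (m + s) * Real.exp (-(k * s))) (Set.Ioi 0) ∧
    ∫ s in Set.Ioi (0 : ℝ), (m + s) * Real.exp (-(k * s)) = m / k + 1 / k ^ 2 := by
  have hd : ∀ s ∈ Set.Ici (0 : ℝ), HasDerivAt
      (fun s => -((m / k + 1 / k ^ 2) * Real.exp (-(k * s)) + s * Real.exp (-(k * s)) / k))
      ((m + s) * Real.exp (-(k * s))) s := by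
    intro s _
    have h1 : HasDerivAt (fun s => Real.exp (-(k * s))) (Real.exp (-(k * s)) * (-(k * 1))) s :=
      (((hasDerivAt_id s).const_mul k).neg).exp
    convert! ((h1.const_mul (m / k + 1 / k ^ 2)).add
      (((hasDerivAt_id s).mul h1).div_const k)).neg using 1
    simp only [id]
    field_simp
    ring
  have hnn : ∀ s ∈ Set.Ioi (0 : ℝ), 0 ≤ (m + s) * Real.exp (-(k * s)) := fun s hs => by
    have : 0 < s := hs
    positivity
  have hlim : Filter.Tendsto
      (fun s => -((m / k + 1 / k ^ 2) * Real.exp (-(k * s)) + s * Real.exp (-(k * s)) / k))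
      Filter.atTop (nhds 0) := by
    have h0 := tendsto_rpow_mul_exp_neg_mul_atTop_nhds_zero 0 k hk
    have h1 := tendsto_rpow_mul_exp_neg_mul_atTop_nhds_zero 1 k hk
    simp only [Real.rpow_zero, Real.rpow_one, one_mul, neg_mul] at h0 h1
    simpa only [mul_zero, zero_div, add_zero, neg_zero] using
      ((h0.const_mul (m / k + 1 / k ^ 2)).add (h1.div_const k)).neg
  refine ⟨integrableOn_Ioi_deriv_of_nonneg' hd hnn hlim, ?_⟩
  rw [integral_Ioi_of_hasDerivAt_of_nonneg' hd hnn hlim]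
  simp

variable {Ω ι : Type*} [MeasurableSpace Ω] [Fintype ι] {μ : Measure Ω} [IsProbabilityMeasure μ]
  {Y : Ω → ℝ} {lam : ι → ℝ}

/-- Outside the ball `√Y ≤ ρ`, the Gaussian tail of `√Y` around `√p` compensates the growth
`exp (Y / 2)` up to an exponential factor, which the slope `ρ / 2 > √p` beats. The integral is
computed by the layer cake formula. -/
lemma IsChiSqMixture.lintegral_tail_le (h : IsChiSqMixture μ Y lam) {p ρ : ℝ}
    (hp : ∑ i, lam i = p) (hρ : √p < ρ / 2) :
    ∫⁻ ω, ENNReal.ofReal ({ω | ρ < √(Y ω)}.indicator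
      (fun ω => Real.exp (Y ω / 2 - ρ * √(Y ω) / 2 + ρ ^ 2 / 6)) ω) ∂μ ≤
    ENNReal.ofReal (Real.exp (-ρ ^ 2 / 3 + ρ * √p - √p ^ 2 / 2) *
      (1 + (ρ / 2 / (ρ / 2 - √p) + 1 / (ρ / 2 - √p) ^ 2))) := by
  have hp0 : 0 ≤ √p := Real.sqrt_nonneg p
  set a := √p with ha
  have hρ0 : 0 < ρ := by linarith
  have hk : 0 < ρ / 2 - a := by linarith
  -- `G s` is the exponent at radius `ρ + s`
  set G : ℝ → ℝ := fun s => (ρ + s) ^ 2 / 2 - ρ * (ρ + s) / 2 + ρ ^ 2 / 6 with hG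
  have hGd : ∀ s, HasDerivAt (fun s => Real.exp (G s)) (Real.exp (G s) * (ρ / 2 + s)) s := by
    intro s
    refine HasDerivAt.exp ?_
    have h1 : HasDerivAt (fun s => ρ + s) 1 s := (hasDerivAt_id s).const_add ρ
    convert! (((h1.fun_pow 2).div_const 2).sub ((h1.const_mul ρ).div_const 2)).add_const
      (ρ ^ 2 / 6) using 1
    norm_num
    ring
  have hgc : Continuous fun s => Real.exp (G s) * (ρ / 2 + s) := by
    simp only [hG]
    fun_prop
  have hFTC : ∀ x, ∫ s in (0 : ℝ)..x, Real.exp (G s) * (ρ / 2 + s) =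
      Real.exp (G x) - Real.exp (G 0) := fun x =>
    intervalIntegral.integral_eq_sub_of_hasDerivAt (fun s _ => hGd s)
      (hgc.intervalIntegrable _ _)
  set f : Ω → ℝ := fun ω => max (√(Y ω) - ρ) 0 with hf
  have hfm : Measurable f := (h.measurable.sqrt.sub_const ρ).max measurable_const
  have hS : MeasurableSet {ω | ρ < √(Y ω)} := measurableSet_lt measurable_const h.measurable.sqrt
  have hcake := lintegral_comp_eq_lintegral_meas_lt_mul (g := fun s => Real.exp (G s) * (ρ / 2 + s))
    μ (f := f) (Filter.Eventually.of_forall fun ω => le_max_right _ _) hfm.aemeasurable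
    (fun t _ => hgc.intervalIntegrable _ _) (by
      filter_upwards [ae_restrict_mem measurableSet_Ioi] with s hs
      have : (0 : ℝ) < s := hs
      positivity)
  have hmeas : ∀ s, 0 ≤ s → μ {ω | ρ + s < √(Y ω)} ≤
      ENNReal.ofReal (Real.exp (-(ρ + s - a) ^ 2 / 2)) := by
    intro s hs
    rw [← ofReal_measureReal]
    refine ENNReal.ofReal_le_ofReal ?_
    have := h.measureReal_gt_le hp (s := ρ + s - a) (by linarith)
    rwa [← ha, show a + (ρ + s - a) = ρ + s by ring] at this
  have hexp : ∀ s, Real.exp (-(ρ + s - a) ^ 2 / 2) * Real.exp (G s) =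
      Real.exp (-ρ ^ 2 / 3 + ρ * a - a ^ 2 / 2) * Real.exp (-((ρ / 2 - a) * s)) := by
    intro s
    rw [← Real.exp_add, ← Real.exp_add]
    congr 1
    simp only [hG]
    ring
  obtain ⟨hint, hval⟩ := integral_linear_mul_exp_neg (m := ρ / 2) (by positivity) hk
  have hstep : ∀ ω, ENNReal.ofReal ({ω | ρ < √(Y ω)}.indicator
      (fun ω => Real.exp (Y ω / 2 - ρ * √(Y ω) / 2 + ρ ^ 2 / 6)) ω) ≤
      {ω | ρ < √(Y ω)}.indicator (fun _ => ENNReal.ofReal (Real.exp (G 0))) ω +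
      ENNReal.ofReal (∫ s in (0 : ℝ)..f ω, Real.exp (G s) * (ρ / 2 + s)) := by
    intro ω
    by_cases hω : ρ < √(Y ω)
    · have hmem : ω ∈ {ω | ρ < √(Y ω)} := hω
      rw [Set.indicator_of_mem hmem, Set.indicator_of_mem hmem, hFTC]
      refine le_trans (le_of_eq ?_) ENNReal.ofReal_add_le
      congr 1
      have : f ω = √(Y ω) - ρ := max_eq_left (by linarith)
      rw [this, add_sub_cancel]
      simp only [hG]
      rw [add_sub_cancel, Real.sq_sqrt (h.nonneg ω)]
    · have hmem : ω ∉ {ω | ρ < √(Y ω)} := hω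
      rw [Set.indicator_of_notMem hmem]
      simp
  calc _ ≤ ∫⁻ ω, {ω | ρ < √(Y ω)}.indicator (fun _ => ENNReal.ofReal (Real.exp (G 0))) ω +
        ENNReal.ofReal (∫ s in (0 : ℝ)..f ω, Real.exp (G s) * (ρ / 2 + s)) ∂μ := lintegral_mono hstep
    _ = ENNReal.ofReal (Real.exp (G 0)) * μ {ω | ρ < √(Y ω)} +
        ∫⁻ s in Set.Ioi 0, μ {ω | s < f ω} * ENNReal.ofReal (Real.exp (G s) * (ρ / 2 + s)) := by
      rw [lintegral_add_left (measurable_const.indicator hS), lintegral_indicator_const hS, hcake]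
    _ ≤ ENNReal.ofReal (Real.exp (-ρ ^ 2 / 3 + ρ * a - a ^ 2 / 2)) +
        ∫⁻ s in Set.Ioi 0, ENNReal.ofReal (Real.exp (-ρ ^ 2 / 3 + ρ * a - a ^ 2 / 2) *
          ((ρ / 2 + s) * Real.exp (-((ρ / 2 - a) * s)))) := by
      refine add_le_add ?_ (setLIntegral_mono' measurableSet_Ioi fun s hs => ?_)
      · have h0 := hmeas 0 le_rfl
        have h1 := hexp 0
        simp only [add_zero, mul_zero, neg_zero, Real.exp_zero, mul_one] at h0 h1
        rw [← h1, mul_comm (Real.exp _), ENNReal.ofReal_mul (Real.exp_pos _).le]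
        exact mul_le_mul_right h0 _
      · have hs0 : (0 : ℝ) < s := hs
        have hset : {ω | s < f ω} = {ω | ρ + s < √(Y ω)} := by
          ext ω
          simp only [hf, Set.mem_ofPred_eq, lt_max_iff, not_lt.2 hs0.le, or_false]
          constructor <;> intro <;> linarith
        rw [hset]
        calc _ ≤ ENNReal.ofReal (Real.exp (-(ρ + s - a) ^ 2 / 2)) *
              ENNReal.ofReal (Real.exp (G s) * (ρ / 2 + s)) := mul_le_mul_left (hmeas s hs0.le) _
          _ = _ := by
            rw [← ENNReal.ofReal_mul (Real.exp_pos _).le, ← mul_assoc, hexp]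
            congr 1
            ring
    _ = _ := by
      rw [← ofReal_integral_eq_lintegral_ofReal (hint.const_mul _), integral_const_mul, hval,
        ← ENNReal.ofReal_add (Real.exp_pos _).le (by positivity)]
      · congr 1
        ring
      · filter_upwards [ae_restrict_mem measurableSet_Ioi] with s hs
        have : (0 : ℝ) < s := hs
        positivity

/-- For `ρ = (4 / 3) (2 a + b)` the bound on the tail integral is at most `4 exp (-b² / 2)`, once
this quantity is smaller than `1`. -/
lemma tail_constant_le {a b : ℝ} (ha : 0 ≤ a) (hb : 0 < b) (hb1 : 4 * Real.exp (-(b ^ 2 / 2)) < 1)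
    {ρ : ℝ} (hρ : ρ = 4 / 3 * (2 * a + b)) :
    Real.exp (-ρ ^ 2 / 3 + ρ * a - a ^ 2 / 2) * (1 + (ρ / 2 / (ρ / 2 - a) + 1 / (ρ / 2 - a) ^ 2)) ≤
      4 * Real.exp (-(b ^ 2 / 2)) := by
  have hb2 : 2.7 ≤ b ^ 2 := by
    have h1 : Real.exp (-(b ^ 2 / 2)) < Real.exp (-(2 * Real.log 2)) := by
      have : Real.exp (-(2 * Real.log 2)) = 1 / 4 := by
        rw [Real.exp_neg, mul_comm, Real.exp_mul, Real.exp_log two_pos]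
        norm_num
      rw [this]
      linarith
    have h2 := Real.exp_lt_exp.1 h1
    have := Real.log_two_gt_d9
    linarith
  have hb3 : 1.6 ≤ b := by nlinarith
  have hk : ρ / 2 - a = (a + 2 * b) / 3 := by rw [hρ]; ring
  have h1 : ρ / 2 / (ρ / 2 - a) = 1 + 3 * a / (a + 2 * b) := by
    rw [hk, hρ]
    field_simp
    ring
  have h2 : 3 * a / (a + 2 * b) ≤ a := by
    rw [div_le_iff₀ (by positivity)]
    nlinarith
  have h3 : 1 / (ρ / 2 - a) ^ 2 ≤ 1 := by
    rw [hk]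
    refine (div_le_one (by positivity)).2 ?_
    nlinarith
  have h4 : -ρ ^ 2 / 3 + ρ * a - a ^ 2 / 2 ≤ -a + -(b ^ 2 / 2) := by
    rw [hρ]
    nlinarith [mul_nonneg ha (sub_nonneg.2 hb3)]
  calc _ ≤ Real.exp (-a + -(b ^ 2 / 2)) * (3 + a) :=
        mul_le_mul (Real.exp_le_exp.2 h4) (by linarith) (by rw [h1]; positivity) (Real.exp_pos _).le
    _ = Real.exp (-(b ^ 2 / 2)) * (Real.exp (-a) * (3 + a)) := by rw [Real.exp_add]; ring
    _ ≤ Real.exp (-(b ^ 2 / 2)) * 4 := by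
      refine mul_le_mul_of_nonneg_left ?_ (Real.exp_pos _).le
      have h5 := Real.add_one_le_exp a
      have : Real.exp (-a) * Real.exp a = 1 := by rw [← Real.exp_add]; simp
      nlinarith [Real.exp_pos (-a)]
    _ = _ := by ring

end Tail

/-! ### Local error -/

section Pointwise

lemma abs_exp_sub_one_le_mul_exp {x M : ℝ} (hx : |x| ≤ M) : |Real.exp x - 1| ≤ M * Real.exp M := by
  have hM : 0 ≤ M := (abs_nonneg x).trans hx
  obtain ⟨h1, h2⟩ := abs_le.1 hx
  have e1 := Real.add_one_le_exp x
  have e2 := Real.add_one_le_exp (-M)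
  have e3 := Real.exp_le_exp.2 h2
  have e4 : Real.exp (-M) * Real.exp M = 1 := by rw [← Real.exp_add]; simp
  have e5 := Real.one_le_exp hM
  rw [abs_le]
  constructor <;> nlinarith [Real.exp_pos M]

/-- Symmetrizing a density makes the odd part of its logarithm contribute only to second order. -/
lemma abs_exp_add_exp_half_sub_one_le {x y M E : ℝ} (hx : |x| ≤ M) (hy : |y| ≤ M)
    (hxy : |(x + y) / 2| ≤ E) :
    |(Real.exp x + Real.exp y) / 2 - 1| ≤ (M ^ 2 / 2 + E) * Real.exp M := by
  have hM : 0 ≤ M := (abs_nonneg x).trans hx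
  have hE : 0 ≤ E := (abs_nonneg _).trans hxy
  obtain ⟨x1, x2⟩ := abs_le.1 hx
  obtain ⟨y1, y2⟩ := abs_le.1 hy
  obtain ⟨s1, s2⟩ := abs_le.1 hxy
  set s := (x + y) / 2 with hs
  set o := (x - y) / 2 with ho
  have hψ : (Real.exp x + Real.exp y) / 2 = Real.exp s * Real.cosh o := by
    rw [Real.cosh_eq, mul_div_assoc', mul_add, ← Real.exp_add, ← Real.exp_add,
      show s + o = x by ring, show s + -o = y by ring]
  have ho2 : o ^ 2 ≤ M ^ 2 := sq_le_sq' (by linarith) (by linarith)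
  have hψM : Real.exp s * Real.cosh o ≤ Real.exp M := by
    rw [← hψ]
    linarith [Real.exp_le_exp.2 x2, Real.exp_le_exp.2 y2]
  have hcosh : Real.cosh o - 1 ≤ o ^ 2 / 2 * Real.cosh o := by
    have h1 := Real.cosh_le_exp_half_sq o
    have h2 := Real.add_one_le_exp (-(o ^ 2 / 2))
    have h3 : Real.exp (-(o ^ 2 / 2)) * Real.exp (o ^ 2 / 2) = 1 := by rw [← Real.exp_add]; simp
    nlinarith [Real.cosh_pos o, Real.exp_pos (-(o ^ 2 / 2))]
  have hsM : Real.exp s ≤ Real.exp M := Real.exp_le_exp.2 (by linarith)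
  have hs1 := Real.add_one_le_exp s
  have hM1 := Real.one_le_exp hM
  have hEM : E ≤ E * Real.exp M := le_mul_of_one_le_right hE hM1
  rw [hψ, abs_le]
  constructor
  · have : Real.exp s ≤ Real.exp s * Real.cosh o :=
      le_mul_of_one_le_right (Real.exp_pos s).le (Real.one_le_cosh o)
    nlinarith [mul_nonneg (sq_nonneg M) (Real.exp_pos M).le]
  · have h1 : Real.exp s * (Real.cosh o - 1) ≤ M ^ 2 / 2 * Real.exp M := by
      calc _ ≤ Real.exp s * (o ^ 2 / 2 * Real.cosh o) :=
            mul_le_mul_of_nonneg_left hcosh (Real.exp_pos s).le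
        _ = o ^ 2 / 2 * (Real.exp s * Real.cosh o) := by ring
        _ ≤ M ^ 2 / 2 * Real.exp M := by gcongr
    have h2 : Real.exp s - 1 ≤ E * Real.exp M := by
      rcases le_total s 0 with h0 | h0
      · have := Real.exp_le_one_iff.2 h0
        nlinarith
      · have h3 := Real.add_one_le_exp (-s)
        have h4 : Real.exp (-s) * Real.exp s = 1 := by rw [← Real.exp_add]; simp
        have h5 : Real.exp s - 1 ≤ s * Real.exp s := by nlinarith [Real.exp_pos s]
        exact h5.trans (mul_le_mul s2 hsM (Real.exp_pos s).le hE)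
    nlinarith

/-- On the ball `z ≤ ρ ≤ 1 / τ` the factor `exp (τ z³ / 6)` is bounded by a constant for
`z ≤ 2 √q`, and is dominated by a quadratic exponential with a small constant beyond. -/
lemma exp_cube_le {τ ρ q β z : ℝ} (hτ : 0 ≤ τ) (hτρ : τ * ρ ≤ 1) (hq : 0 ≤ q)
    (hβ : τ * √q ^ 3 ≤ β) (hz : 0 ≤ z) (hzρ : z ≤ ρ) :
    Real.exp (τ * z ^ 3 / 6) ≤
      Real.exp (4 * β / 3) + Real.exp (-(5 * q / 6)) * Real.exp (3 / 4 * (z ^ 2 / 2)) := by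
  rcases le_total z (2 * √q) with h | h
  · have h1 : z ^ 3 ≤ (2 * √q) ^ 3 := pow_le_pow_left₀ hz h 3
    have h2 : τ * z ^ 3 / 6 ≤ 4 * β / 3 := by nlinarith [mul_le_mul_of_nonneg_left h1 hτ]
    have := Real.exp_le_exp.2 h2
    linarith [mul_pos (Real.exp_pos (-(5 * q / 6))) (Real.exp_pos (3 / 4 * (z ^ 2 / 2)))]
  · have h1 : (2 * √q) ^ 2 ≤ z ^ 2 := pow_le_pow_left₀ (by positivity) h 2
    rw [mul_pow, Real.sq_sqrt hq] at h1
    have h2 : τ * z ≤ 1 := (mul_le_mul_of_nonneg_left hzρ hτ).trans hτρ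
    have h3 : τ * z ^ 3 / 6 ≤ -(5 * q / 6) + 3 / 4 * (z ^ 2 / 2) := by
      nlinarith [mul_le_mul_of_nonneg_right h2 (sq_nonneg z)]
    rw [← Real.exp_add]
    linarith [Real.exp_le_exp.2 h3, Real.exp_pos (4 * β / 3)]

end Pointwise

section Moments

variable {Ω ι : Type*} [MeasurableSpace Ω] [Fintype ι] {μ : Measure Ω} {Y : Ω → ℝ} {lam : ι → ℝ}

/-- The tilted moments at `θ = 3 / 4`, compensated by `exp (-5 (p + c) / 6)`. This uses
`2 exp (-5 / 6) ≤ 1`. -/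
lemma IsChiSqMixture.compensated_moments_le (h : IsChiSqMixture μ Y lam) {p : ℝ}
    (hp : ∑ i, lam i = p) (c : ℕ) :
    (Real.exp (-(5 * (p + c) / 6)) * ∫ ω, Y ω ^ 1 * Real.exp (3 / 4 * (Y ω / 2)) ∂μ ≤
      (1 / 2) ^ c * (4 * p)) ∧
    (Real.exp (-(5 * (p + c) / 6)) * ∫ ω, Y ω ^ 2 * Real.exp (3 / 4 * (Y ω / 2)) ∂μ ≤
      (1 / 2) ^ c * (16 * (p * (p + 2)))) ∧
    (Real.exp (-(5 * (p + c) / 6)) * ∫ ω, Y ω ^ 3 * Real.exp (3 / 4 * (Y ω / 2)) ∂μ ≤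
      (1 / 2) ^ c * (64 * (p * (p + 2) * (p + 4)))) := by
  have hp0 : 0 ≤ p := hp ▸ Finset.sum_nonneg fun i _ => h.weight_nonneg i
  obtain ⟨m1, m2, m3⟩ := h.integral_pow_le (θ := 3 / 4) (by norm_num) (by norm_num) hp
  have hlog : Real.log (1 - 3 / 4) = -(2 * Real.log 2) := by
    rw [show (1 : ℝ) - 3 / 4 = (2 ^ 2)⁻¹ by norm_num, Real.log_inv, Real.log_pow]
    norm_num
  have hc : Real.exp (-(5 * (p + c) / 6)) * Real.exp (-(1 / 2) * p * Real.log (1 - 3 / 4)) ≤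
      (1 / 2) ^ c := by
    have h2 := Real.log_two_lt_d9
    have : ((1 : ℝ) / 2) ^ c = Real.exp (-(c * Real.log 2)) := by
      rw [Real.exp_neg, mul_comm, Real.exp_mul, Real.exp_log two_pos, Real.rpow_natCast, one_div,
        inv_pow]
    rw [this, hlog, ← Real.exp_add]
    refine Real.exp_le_exp.2 ?_
    have hc0 : (0 : ℝ) ≤ c := c.cast_nonneg
    nlinarith
  have key : ∀ I x y : ℝ, 0 ≤ x → I ≤ Real.exp (-(1 / 2) * p * Real.log (1 - 3 / 4)) * x → x = y →
      Real.exp (-(5 * (p + c) / 6)) * I ≤ (1 / 2) ^ c * y := by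
    intro I x y hx hI hxy
    calc _ ≤ Real.exp (-(5 * (p + c) / 6)) *
          (Real.exp (-(1 / 2) * p * Real.log (1 - 3 / 4)) * x) :=
          mul_le_mul_of_nonneg_left hI (Real.exp_pos _).le
      _ = Real.exp (-(5 * (p + c) / 6)) * Real.exp (-(1 / 2) * p * Real.log (1 - 3 / 4)) * x := by
          ring
      _ ≤ (1 / 2) ^ c * x := mul_le_mul_of_nonneg_right hc hx
      _ = _ := by rw [hxy]
  exact ⟨key _ _ _ (by norm_num; positivity) m1 (by ring),
    key _ _ _ (by norm_num; positivity) m2 (by ring), key _ _ _ (by norm_num; positivity) m3 (by ring)⟩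

lemma IsChiSqMixture.moments_le (h : IsChiSqMixture μ Y lam) {p : ℝ} (hp : ∑ i, lam i = p) :
    ∫ ω, Y ω ^ 1 ∂μ ≤ p ∧ ∫ ω, Y ω ^ 2 ∂μ ≤ p * (p + 2) ∧
      ∫ ω, Y ω ^ 3 ∂μ ≤ p * (p + 2) * (p + 4) := by
  simpa using h.integral_pow_le (θ := 0) le_rfl one_pos hp

lemma IsChiSqMixture.integrable_pow (h : IsChiSqMixture μ Y lam) (k : ℕ) :
    Integrable (fun ω => Y ω ^ k) μ := by
  simpa using h.integrable_pow_mul_exp one_pos k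

/-- A majorant of the local error `|exp x - 1|`, `|x| ≤ τ Y^{3/2} / 6`, in total variation. The ball
is split at `√Y = 2 √(p + 1)`, and the moments on both parts are those of a chi-square law. -/
lemma IsChiSqMixture.exists_majorant_tv (h : IsChiSqMixture μ Y lam) {p τ ρ : ℝ}
    (hp : ∑ i, lam i = p) (hτ : 0 ≤ τ) (hτρ : τ * ρ ≤ 1) (hsmall : 2 * (τ * √(p + 1) ^ 3) ≤ 1) :
    ∃ H : Ω → ℝ, Integrable H μ ∧ (∀ ω, 0 ≤ H ω) ∧ ∫ ω, H ω ∂μ ≤ 2 * (τ * √(p + 1) ^ 3) ∧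
      ∀ ω, √(Y ω) ≤ ρ → ∀ x, |x| ≤ τ * √(Y ω) ^ 3 / 6 → |Real.exp x - 1| ≤ H ω := by
  have hp0 : 0 ≤ p := hp ▸ Finset.sum_nonneg fun i _ => h.weight_nonneg i
  have hq : 0 < √(p + 1) := Real.sqrt_pos.2 (by linarith)
  have hqq : √(p + 1) ^ 2 = p + 1 := Real.sq_sqrt (by linarith)
  set q := √(p + 1) with hqdef
  -- by the arithmetic-geometric mean inequality, `√Y³ ≤ (q Y + Y² / q) / 2`
  set φ : Ω → ℝ := fun ω => τ / 12 * (q * Y ω ^ 1 + Y ω ^ 2 / q) with hφ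
  have hφ0 : ∀ ω, 0 ≤ φ ω := fun ω => by
    have := h.nonneg ω
    positivity
  have hi1 : Integrable φ μ := (((h.integrable_pow 1).const_mul q).add ((h.integrable_pow 2).div_const q)).const_mul
    (τ / 12)
  have hj := fun k => h.integrable_pow_mul_exp (θ := 3 / 4) (by norm_num) k
  have hi2 := (((hj 1).const_mul q).add ((hj 2).div_const q)).const_mul (τ / 12)
  have hφe : ∀ ω, φ ω * Real.exp (3 / 4 * (Y ω / 2)) = τ / 12 *
      (q * (Y ω ^ 1 * Real.exp (3 / 4 * (Y ω / 2))) +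
        Y ω ^ 2 * Real.exp (3 / 4 * (Y ω / 2)) / q) := fun ω => by
    simp only [hφ]
    ring
  have hi2' : Integrable (fun ω => φ ω * Real.exp (3 / 4 * (Y ω / 2))) μ := by
    simp_rw [hφe]
    exact hi2
  refine ⟨fun ω => Real.exp (4 * (1 / 2) / 3) * φ ω + Real.exp (-(5 * (p + 1) / 6)) *
    (φ ω * Real.exp (3 / 4 * (Y ω / 2))), ?_, ?_, ?_, ?_⟩
  · exact (hi1.const_mul _).add (hi2'.const_mul _)
  · intro ω
    have := hφ0 ω
    positivity
  · beta_reduce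
    rw [integral_add (hi1.const_mul _) (hi2'.const_mul _), integral_const_mul, integral_const_mul]
    simp_rw [hφe]
    simp only [integral_const_mul]
    rw [integral_add ((h.integrable_pow 1).const_mul q) ((h.integrable_pow 2).div_const q),
      integral_add ((hj 1).const_mul q) ((hj 2).div_const q), integral_const_mul, integral_const_mul,
      integral_div, integral_div]
    obtain ⟨m1, m2, -⟩ := h.moments_le hp
    obtain ⟨c1, c2, -⟩ := h.compensated_moments_le hp 1
    push_cast at c1 c2
    set I1 := ∫ ω, Y ω ^ 1 ∂μ
    set I2 := ∫ ω, Y ω ^ 2 ∂μ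
    set J1 := ∫ ω, Y ω ^ 1 * Real.exp (3 / 4 * (Y ω / 2)) ∂μ
    set J2 := ∫ ω, Y ω ^ 2 * Real.exp (3 / 4 * (Y ω / 2)) ∂μ
    -- here `2 / 3 ≤ log 2`
    have he : Real.exp (4 * (1 / 2) / 3) ≤ 2 := by
      rw [← Real.le_log_iff_exp_le two_pos]
      linarith [Real.log_two_gt_d9]
    have hI1 : 0 ≤ I1 := integral_nonneg fun ω => pow_nonneg (h.nonneg ω) 1
    have hI2 : 0 ≤ I2 := integral_nonneg fun ω => pow_nonneg (h.nonneg ω) 2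
    have hpq : p ≤ q ^ 2 := by linarith
    have hpq2 : p * (p + 2) ≤ q ^ 4 := by
      have : q ^ 4 = (q ^ 2) ^ 2 := by ring
      rw [this, hqq]
      nlinarith
    have e1 : q * I1 + I2 / q ≤ 2 * q ^ 3 := by
      have a1 : q * I1 ≤ q * q ^ 2 := mul_le_mul_of_nonneg_left (m1.trans hpq) hq.le
      have a2 : I2 / q ≤ q ^ 3 := by
        rw [div_le_iff₀ hq]
        calc I2 ≤ q ^ 4 := m2.trans hpq2
          _ = q ^ 3 * q := by ring
      nlinarith
    have e2 : Real.exp (-(5 * (p + 1) / 6)) * (q * J1 + J2 / q) ≤ 10 * q ^ 3 := by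
      have a1 : q * (Real.exp (-(5 * (p + 1) / 6)) * J1) ≤ q * (2 * q ^ 2) :=
        mul_le_mul_of_nonneg_left (by linarith) hq.le
      have a2 : Real.exp (-(5 * (p + 1) / 6)) * J2 / q ≤ 8 * q ^ 3 := by
        rw [div_le_iff₀ hq]
        calc _ ≤ 8 * q ^ 4 := by linarith
          _ = 8 * q ^ 3 * q := by ring
      calc _ = q * (Real.exp (-(5 * (p + 1) / 6)) * J1) +
            Real.exp (-(5 * (p + 1) / 6)) * J2 / q := by ring
        _ ≤ _ := by nlinarith
    have e3 : Real.exp (4 * (1 / 2) / 3) * (q * I1 + I2 / q) ≤ 2 * (2 * q ^ 3) :=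
      mul_le_mul he e1 (by positivity) (by norm_num)
    have hq3 : 0 ≤ q ^ 3 := by positivity
    calc _ = τ / 12 * (Real.exp (4 * (1 / 2) / 3) * (q * I1 + I2 / q) +
          Real.exp (-(5 * (p + 1) / 6)) * (q * J1 + J2 / q)) := by ring
      _ ≤ τ / 12 * (2 * (2 * q ^ 3) + 10 * q ^ 3) := by gcongr
      _ ≤ _ := by nlinarith [mul_nonneg hτ hq3]
  · intro ω hω x hx
    have hY := h.nonneg ω
    have hs := Real.sqrt_nonneg (Y ω)
    have hsq := Real.sq_sqrt hY
    set z := √(Y ω) with hz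
    have hcube := exp_cube_le (q := p + 1) (β := 1 / 2) hτ hτρ (by linarith)
      (by rw [← hqdef]; linarith) hs hω
    rw [hsq] at hcube
    have hMφ : τ * z ^ 3 / 6 ≤ φ ω := by
      have : z ^ 3 ≤ (q * Y ω ^ 1 + Y ω ^ 2 / q) / 2 := by
        rw [← hsq, pow_one]
        have : (q * z ^ 2 + (z ^ 2) ^ 2 / q) / 2 - z ^ 3 = z ^ 2 * (q - z) ^ 2 / (2 * q) := by
          field_simp
          ring
        have h2 : 0 ≤ z ^ 2 * (q - z) ^ 2 / (2 * q) := by positivity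
        linarith
      simp only [hφ]
      nlinarith
    calc _ ≤ τ * z ^ 3 / 6 * Real.exp (τ * z ^ 3 / 6) := abs_exp_sub_one_le_mul_exp hx
      _ ≤ φ ω * (Real.exp (4 * (1 / 2) / 3) +
          Real.exp (-(5 * (p + 1) / 6)) * Real.exp (3 / 4 * (Y ω / 2))) :=
        mul_le_mul hMφ hcube (Real.exp_pos _).le (hφ0 ω)
      _ = _ := by ring

/-- A majorant of the local error for symmetric sets, of second order in the bound
`τ Y^{3/2} / 6` and of first order in the bound `σ Y² / 24` on the even part. The ball is split at
`√Y = 2 √(p + 2)`. -/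
lemma IsChiSqMixture.exists_majorant_symm (h : IsChiSqMixture μ Y lam) {p τ σ ρ : ℝ}
    (hp : ∑ i, lam i = p) (hτ : 0 ≤ τ) (hσ : 0 ≤ σ) (hτρ : τ * ρ ≤ 1)
    (hsmall : 4 / 9 * (τ ^ 2 * (p + 2) ^ 3) ≤ 1) :
    ∃ H : Ω → ℝ, Integrable H μ ∧ (∀ ω, 0 ≤ H ω) ∧
      ∫ ω, H ω ∂μ ≤ 4 / 9 * (τ ^ 2 * (p + 2) ^ 3 + 2 * (σ * (p + 1) ^ 2)) ∧
      ∀ ω, √(Y ω) ≤ ρ → ∀ x y, |x| ≤ τ * √(Y ω) ^ 3 / 6 → |y| ≤ τ * √(Y ω) ^ 3 / 6 →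
        |(x + y) / 2| ≤ σ * √(Y ω) ^ 4 / 24 → |(Real.exp x + Real.exp y) / 2 - 1| ≤ H ω := by
  have hp0 : 0 ≤ p := hp ▸ Finset.sum_nonneg fun i _ => h.weight_nonneg i
  have hβ : τ * √(p + 2) ^ 3 ≤ 3 / 2 := by
    refine le_of_sq_le_sq ?_ (by norm_num)
    have : (τ * √(p + 2) ^ 3) ^ 2 = τ ^ 2 * (√(p + 2) ^ 2) ^ 3 := by ring
    rw [this, Real.sq_sqrt (by linarith)]
    linarith
  set φ : Ω → ℝ := fun ω => τ ^ 2 / 72 * Y ω ^ 3 + σ / 24 * Y ω ^ 2 with hφ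
  have hφ0 : ∀ ω, 0 ≤ φ ω := fun ω => by
    have := h.nonneg ω
    positivity
  have hi1 : Integrable φ μ := ((h.integrable_pow 3).const_mul (τ ^ 2 / 72)).add
    ((h.integrable_pow 2).const_mul (σ / 24))
  have hj := fun k => h.integrable_pow_mul_exp (θ := 3 / 4) (by norm_num) k
  have hi2 := ((hj 3).const_mul (τ ^ 2 / 72)).add ((hj 2).const_mul (σ / 24))
  have hφe : ∀ ω, φ ω * Real.exp (3 / 4 * (Y ω / 2)) =
      τ ^ 2 / 72 * (Y ω ^ 3 * Real.exp (3 / 4 * (Y ω / 2))) +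
        σ / 24 * (Y ω ^ 2 * Real.exp (3 / 4 * (Y ω / 2))) := fun ω => by
    simp only [hφ]
    ring
  have hi2' : Integrable (fun ω => φ ω * Real.exp (3 / 4 * (Y ω / 2))) μ := by
    simp_rw [hφe]
    exact hi2
  refine ⟨fun ω => Real.exp (4 * (3 / 2) / 3) * φ ω + Real.exp (-(5 * (p + 2) / 6)) *
    (φ ω * Real.exp (3 / 4 * (Y ω / 2))), ?_, ?_, ?_, ?_⟩
  · exact (hi1.const_mul _).add (hi2'.const_mul _)
  · intro ω
    have := hφ0 ω
    positivity
  · beta_reduce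
    rw [integral_add (hi1.const_mul _) (hi2'.const_mul _), integral_const_mul, integral_const_mul]
    simp_rw [hφe]
    simp only [hφ]
    rw [integral_add ((h.integrable_pow 3).const_mul _) ((h.integrable_pow 2).const_mul _),
      integral_add ((hj 3).const_mul _) ((hj 2).const_mul _), integral_const_mul, integral_const_mul,
      integral_const_mul, integral_const_mul]
    obtain ⟨-, m2, m3⟩ := h.moments_le hp
    obtain ⟨-, c2, c3⟩ := h.compensated_moments_le hp 2
    push_cast at c2 c3
    set I2 := ∫ ω, Y ω ^ 2 ∂μ
    set I3 := ∫ ω, Y ω ^ 3 ∂μ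
    set J2 := ∫ ω, Y ω ^ 2 * Real.exp (3 / 4 * (Y ω / 2)) ∂μ
    set J3 := ∫ ω, Y ω ^ 3 * Real.exp (3 / 4 * (Y ω / 2)) ∂μ
    have he : Real.exp (4 * (3 / 2) / 3) ≤ 8 := by
      rw [← Real.le_log_iff_exp_le (by norm_num), show (8 : ℝ) = 2 ^ 3 by norm_num, Real.log_pow]
      push_cast
      linarith [Real.log_two_gt_d9]
    have hI2 : 0 ≤ I2 := integral_nonneg fun ω => pow_nonneg (h.nonneg ω) 2
    have hI3 : 0 ≤ I3 := integral_nonneg fun ω => pow_nonneg (h.nonneg ω) 3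
    have hp2 : p * (p + 2) ≤ (p + 1) ^ 2 := by nlinarith
    have hp3 : p * (p + 2) * (p + 4) ≤ (p + 2) ^ 3 := by nlinarith
    have e2 : Real.exp (4 * (3 / 2) / 3) * I2 ≤ 8 * (p + 1) ^ 2 :=
      mul_le_mul he (m2.trans hp2) hI2 (by norm_num)
    have e3 : Real.exp (4 * (3 / 2) / 3) * I3 ≤ 8 * (p + 2) ^ 3 :=
      mul_le_mul he (m3.trans hp3) hI3 (by norm_num)
    have f2 : Real.exp (4 * (3 / 2) / 3) * I2 + Real.exp (-(5 * (p + 2) / 6)) * J2 ≤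
        64 / 3 * (p + 1) ^ 2 := by nlinarith
    have f3 : Real.exp (4 * (3 / 2) / 3) * I3 + Real.exp (-(5 * (p + 2) / 6)) * J3 ≤
        32 * (p + 2) ^ 3 := by
      have : 0 ≤ (p + 2) ^ 3 := by positivity
      linarith
    calc _ = τ ^ 2 / 72 * (Real.exp (4 * (3 / 2) / 3) * I3 + Real.exp (-(5 * (p + 2) / 6)) * J3) +
          σ / 24 * (Real.exp (4 * (3 / 2) / 3) * I2 + Real.exp (-(5 * (p + 2) / 6)) * J2) := by ring
      _ ≤ τ ^ 2 / 72 * (32 * (p + 2) ^ 3) + σ / 24 * (64 / 3 * (p + 1) ^ 2) := by gcongr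
      _ = _ := by ring
  · intro ω hω x y hx hy hxy
    have hY := h.nonneg ω
    have hs := Real.sqrt_nonneg (Y ω)
    have hsq := Real.sq_sqrt hY
    set z := √(Y ω) with hz
    have hcube := exp_cube_le (q := p + 2) (β := 3 / 2) hτ hτρ (by linarith) hβ hs hω
    rw [hsq] at hcube
    have hMφ : (τ * z ^ 3 / 6) ^ 2 / 2 + σ * z ^ 4 / 24 = φ ω := by
      simp only [hφ]
      rw [← hsq]
      ring
    calc _ ≤ ((τ * z ^ 3 / 6) ^ 2 / 2 + σ * z ^ 4 / 24) * Real.exp (τ * z ^ 3 / 6) :=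
          abs_exp_add_exp_half_sub_one_le hx hy hxy
      _ ≤ φ ω * (Real.exp (4 * (3 / 2) / 3) +
          Real.exp (-(5 * (p + 2) / 6)) * Real.exp (3 / 4 * (Y ω / 2))) := by
        rw [hMφ]
        exact mul_le_mul_of_nonneg_left hcube (hφ0 ω)
      _ = _ := by ring

variable [IsProbabilityMeasure μ]

/-- The integrable majorant of a density outside the ball `√Y ≤ ρ`. -/
lemma IsChiSqMixture.integrable_tail (h : IsChiSqMixture μ Y lam) {p ρ : ℝ}
    (hp : ∑ i, lam i = p) (hρ : √p < ρ / 2) :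
    Integrable ({ω | ρ < √(Y ω)}.indicator
      (fun ω => Real.exp (Y ω / 2 - ρ * √(Y ω) / 2 + ρ ^ 2 / 6))) μ := by
  have hY := h.measurable
  have hS : MeasurableSet {ω | ρ < √(Y ω)} := measurableSet_lt measurable_const hY.sqrt
  refine ⟨(Measurable.indicator (by fun_prop) hS).aestronglyMeasurable, ?_⟩
  rw [hasFiniteIntegral_iff_ofReal (Filter.Eventually.of_forall fun ω =>
    Set.indicator_nonneg (fun _ _ => (Real.exp_pos _).le) ω)]
  exact (h.lintegral_tail_le hp hρ).trans_lt ENNReal.ofReal_lt_top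

lemma IsChiSqMixture.integrable_density (h : IsChiSqMixture μ Y lam) {p ρ K : ℝ}
    (hp : ∑ i, lam i = p) (hρ : √p < ρ / 2) {F : Ω → ℝ} (hF : Measurable F) (hF0 : ∀ ω, 0 ≤ F ω)
    (hin : ∀ ω, √(Y ω) ≤ ρ → F ω ≤ K)
    (hout : ∀ ω, ρ < √(Y ω) → F ω ≤ Real.exp (Y ω / 2 - ρ * √(Y ω) / 2 + ρ ^ 2 / 6)) :
    Integrable F μ := by
  refine ((integrable_const (max K 0)).add (h.integrable_tail hp hρ)).mono'
    hF.aestronglyMeasurable (Filter.Eventually.of_forall fun ω => ?_)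
  rw [Real.norm_of_nonneg (hF0 ω)]
  by_cases hω : ρ < √(Y ω)
  · simp only [Pi.add_apply]
    rw [Set.indicator_of_mem (by exact hω)]
    linarith [hout ω hω, le_max_right K 0]
  · simp only [Pi.add_apply]
    rw [Set.indicator_of_notMem (by exact hω)]
    linarith [hin ω (not_lt.1 hω), le_max_left K 0]

/-- A density that is close to `1` for `√Y ≤ ρ` and satisfies the exponential growth bound beyond
defines, after normalization, a measure close to `μ`. -/
lemma IsChiSqMixture.abs_setIntegral_div_sub_le (h : IsChiSqMixture μ Y lam) {p ρ t C : ℝ}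
    (hp : ∑ i, lam i = p) (ht : 0 < t) (ht1 : 4 * Real.exp (-t) < 1)
    (hρ : ρ = 4 / 3 * (2 * √p + √(2 * t))) {F H : Ω → ℝ} (hF : Integrable F μ)
    (hF0 : ∀ ω, 0 ≤ F ω) (hFpos : 0 < ∫ ω, F ω ∂μ) (hH : Integrable H μ) (hH0 : ∀ ω, 0 ≤ H ω)
    (hHC : ∫ ω, H ω ∂μ ≤ C) (hin : ∀ ω, √(Y ω) ≤ ρ → |F ω - 1| ≤ H ω)
    (hout : ∀ ω, ρ < √(Y ω) → F ω ≤ Real.exp (Y ω / 2 - ρ * √(Y ω) / 2 + ρ ^ 2 / 6))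
    {A : Set Ω} (hA : MeasurableSet A) :
    |(∫ ω in A, F ω ∂μ) / (∫ ω, F ω ∂μ) - μ.real A| ≤ C + 4 * Real.exp (-t) := by
  have ha := Real.sqrt_nonneg p
  have hb : 0 < √(2 * t) := Real.sqrt_pos.2 (by linarith)
  have hb2 : √(2 * t) ^ 2 / 2 = t := by rw [Real.sq_sqrt (by linarith)]; ring
  have hρ2 : √p < ρ / 2 := by rw [hρ]; linarith
  have hS : MeasurableSet {ω | ρ < √(Y ω)} := measurableSet_lt measurable_const h.measurable.sqrt
  set T : Ω → ℝ := {ω | ρ < √(Y ω)}.indicator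
    (fun ω => Real.exp (Y ω / 2 - ρ * √(Y ω) / 2 + ρ ^ 2 / 6)) with hT
  have hT0 : ∀ ω, 0 ≤ T ω := fun ω => Set.indicator_nonneg (fun _ _ => (Real.exp_pos _).le) ω
  have hTi : Integrable T μ := h.integrable_tail hp hρ2
  have hTC : ∫ ω, T ω ∂μ ≤ 4 * Real.exp (-t) := by
    have hle : ∫ ω, T ω ∂μ ≤ Real.exp (-ρ ^ 2 / 3 + ρ * √p - √p ^ 2 / 2) *
        (1 + (ρ / 2 / (ρ / 2 - √p) + 1 / (ρ / 2 - √p) ^ 2)) := by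
      rw [integral_eq_lintegral_of_nonneg_ae (Filter.Eventually.of_forall hT0)
        hTi.aestronglyMeasurable]
      refine ENNReal.toReal_le_of_le_ofReal ?_ (h.lintegral_tail_le hp hρ2)
      have : 0 < ρ / 2 - √p := by linarith
      have : 0 < ρ := by linarith
      positivity
    refine hle.trans ?_
    have := tail_constant_le ha hb (by rwa [hb2]) hρ
    rwa [hb2] at this
  have hout_prob : μ.real {ω | ρ < √(Y ω)} ≤ 4 * Real.exp (-t) := by
    have h1 := h.measureReal_gt_le hp (s := ρ - √p) (by linarith)
    rw [add_sub_cancel] at h1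
    refine h1.trans ?_
    have h2 : √(2 * t) ^ 2 ≤ (ρ - √p) ^ 2 := pow_le_pow_left₀ hb.le (by rw [hρ]; linarith) 2
    have h3 : Real.exp (-(ρ - √p) ^ 2 / 2) ≤ Real.exp (-t) := Real.exp_le_exp.2 (by linarith)
    linarith [Real.exp_pos (-t)]
  set O : Ω → ℝ := {ω | ρ < √(Y ω)}.indicator (fun _ => (1 : ℝ)) with hO
  have hO0 : ∀ ω, 0 ≤ O ω := fun ω => Set.indicator_nonneg (fun _ _ => zero_le_one) ω
  have hOi : Integrable O μ := (integrable_const (1 : ℝ)).indicator hS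
  have hOC : ∫ ω, O ω ∂μ ≤ 4 * Real.exp (-t) := by
    rw [hO, integral_indicator_const _ hS]
    simpa using hout_prob
  refine LaplaceApprox.abs_setIntegral_div_sub_le hF hF0 hFpos (hH.add hTi) (hH.add hOi)
    (fun ω => add_nonneg (hH0 ω) (hT0 ω)) (fun ω => add_nonneg (hH0 ω) (hO0 ω)) ?_ ?_ ?_ ?_ hA
  · intro ω
    simp only [Pi.add_apply]
    by_cases hω : ρ < √(Y ω)
    · rw [hT, Set.indicator_of_mem (by exact hω)]
      linarith [hout ω hω, hH0 ω]
    · linarith [le_abs_self (F ω - 1), hin ω (not_lt.1 hω), hT0 ω]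
  · intro ω
    simp only [Pi.add_apply]
    by_cases hω : ρ < √(Y ω)
    · rw [hO, Set.indicator_of_mem (by exact hω)]
      linarith [hF0 ω, hH0 ω]
    · linarith [neg_abs_le (F ω - 1), hin ω (not_lt.1 hω), hO0 ω]
  · rw [integral_add' hH hTi]
    linarith
  · rw [integral_add' hH hOi]
    linarith

end Moments

/-! ### Taylor expansion at the maximum -/

section Taylor

open Nat in
lemma abs_le_of_abs_deriv_le {g g' : ℝ → ℝ} {K : ℝ} (k : ℕ)
    (hg : ∀ s ∈ Set.Icc (0 : ℝ) 1, HasDerivAt g (g' s) s) (h0 : g 0 = 0)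
    (hb : ∀ s ∈ Set.Icc (0 : ℝ) 1, |g' s| ≤ K * s ^ k / k !) :
    ∀ s ∈ Set.Icc (0 : ℝ) 1, |g s| ≤ K * s ^ (k + 1) / (k + 1)! := by
  intro s hs
  refine image_norm_le_of_norm_deriv_right_le_deriv_boundary (f := g) (f' := g')
    (B := fun s => K * s ^ (k + 1) / (k + 1)!) (B' := fun s => K * s ^ k / k !)
    (fun x hx => (hg x hx).continuousAt.continuousWithinAt)
    (fun x hx => (hg x ⟨hx.1, hx.2.le⟩).hasDerivWithinAt) (by simp [h0]) (fun x => ?_)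
    (fun x hx => hb x ⟨hx.1, hx.2.le⟩) hs
  convert! ((hasDerivAt_pow (k + 1) x).const_mul K).div_const ((k + 1)! : ℝ) using 1
  rw [Nat.factorial_succ]
  push_cast
  have h1 : (k ! : ℝ) ≠ 0 := by exact_mod_cast k.factorial_ne_zero
  have h2 : (k : ℝ) + 1 ≠ 0 := by positivity
  field_simp

/-- Taylor's formula with a bounded third derivative, for the function and its derivative. -/
lemma taylor_three {g g₁ g₂ g₃ : ℝ → ℝ} {K : ℝ} (h0 : ∀ s ∈ Set.Icc (0 : ℝ) 1, HasDerivAt g (g₁ s) s)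
    (h1 : ∀ s ∈ Set.Icc (0 : ℝ) 1, HasDerivAt g₁ (g₂ s) s)
    (h2 : ∀ s ∈ Set.Icc (0 : ℝ) 1, HasDerivAt g₂ (g₃ s) s)
    (hb : ∀ s ∈ Set.Icc (0 : ℝ) 1, |g₃ s| ≤ K) :
    |g 1 - g 0 - g₁ 0 - g₂ 0 / 2| ≤ K / 6 ∧ |g₁ 1 - g₁ 0 - g₂ 0| ≤ K / 2 := by
  have a2 := abs_le_of_abs_deriv_le (g := fun s => g₂ s - g₂ 0) (g' := g₃) (K := K) 0
    (fun s hs => (h2 s hs).sub_const _) (by simp) (fun s hs => by simpa using hb s hs)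
  have a1 := abs_le_of_abs_deriv_le (g := fun s => g₁ s - g₁ 0 - s * g₂ 0) (K := K) 1
    (fun s hs => ((h1 s hs).sub_const _).sub (by simpa using (hasDerivAt_id s).mul_const (g₂ 0)))
    (by simp) a2
  have a0 := abs_le_of_abs_deriv_le (g := fun s => g s - g 0 - s * g₁ 0 - s ^ 2 / 2 * g₂ 0)
    (K := K) 2 (fun s hs => (((h0 s hs).sub_const _).sub
      (by simpa using (hasDerivAt_id s).mul_const (g₁ 0))).sub
      (by simpa using ((hasDerivAt_pow 2 s).div_const 2).mul_const (g₂ 0))) (by simp) a1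
  have b1 := a1 1 (by simp)
  have b0 := a0 1 (by simp)
  norm_num [Nat.factorial] at b0 b1
  refine ⟨?_, b1⟩
  convert b0 using 2
  ring

lemma taylor_four {g g₁ g₂ g₃ g₄ : ℝ → ℝ} {K : ℝ}
    (h0 : ∀ s ∈ Set.Icc (0 : ℝ) 1, HasDerivAt g (g₁ s) s)
    (h1 : ∀ s ∈ Set.Icc (0 : ℝ) 1, HasDerivAt g₁ (g₂ s) s)
    (h2 : ∀ s ∈ Set.Icc (0 : ℝ) 1, HasDerivAt g₂ (g₃ s) s)
    (h3 : ∀ s ∈ Set.Icc (0 : ℝ) 1, HasDerivAt g₃ (g₄ s) s)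
    (hb : ∀ s ∈ Set.Icc (0 : ℝ) 1, |g₄ s| ≤ K) :
    |g 1 - g 0 - g₁ 0 - g₂ 0 / 2 - g₃ 0 / 6| ≤ K / 24 := by
  have a3 := abs_le_of_abs_deriv_le (g := fun s => g₃ s - g₃ 0) (g' := g₄) (K := K) 0
    (fun s hs => (h3 s hs).sub_const _) (by simp) (fun s hs => by simpa using hb s hs)
  have a2 := abs_le_of_abs_deriv_le (g := fun s => g₂ s - g₂ 0 - s * g₃ 0) (K := K) 1
    (fun s hs => ((h2 s hs).sub_const _).sub (by simpa using (hasDerivAt_id s).mul_const (g₃ 0)))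
    (by simp) a3
  have a1 := abs_le_of_abs_deriv_le (g := fun s => g₁ s - g₁ 0 - s * g₂ 0 - s ^ 2 / 2 * g₃ 0)
    (K := K) 2 (fun s hs => (((h1 s hs).sub_const _).sub
      (by simpa using (hasDerivAt_id s).mul_const (g₂ 0))).sub
      (by simpa using ((hasDerivAt_pow 2 s).div_const 2).mul_const (g₃ 0))) (by simp) a2
  have a0 := abs_le_of_abs_deriv_le
    (g := fun s => g s - g 0 - s * g₁ 0 - s ^ 2 / 2 * g₂ 0 - s ^ 3 / 6 * g₃ 0)
    (K := K) 3 (fun s hs => ((((h0 s hs).sub_const _).sub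
      (by simpa using (hasDerivAt_id s).mul_const (g₁ 0))).sub
      (by simpa using ((hasDerivAt_pow 2 s).div_const 2).mul_const (g₂ 0))).sub
      (by
        have := ((hasDerivAt_pow 3 s).div_const 6).mul_const (g₃ 0)
        have e : ((3 : ℕ) : ℝ) * s ^ (3 - 1) / 6 = s ^ 2 / 2 := by
          norm_num
          ring
        rwa [e] at this)) (by simp) a1
  have b0 := a0 1 (by simp)
  norm_num [Nat.factorial] at b0
  convert b0 using 2
  ring

lemma hasDerivAt_iteratedFDeriv_line {E : Type*} [NormedAddCommGroup E] [NormedSpace ℝ E]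
    {f : E → ℝ} {x u : E} {s : ℝ} {k : ℕ} {m : WithTop ℕ∞} (hf : ContDiffAt ℝ m f (x + s • u))
    (hk : k < m) :
    HasDerivAt (fun s : ℝ => iteratedFDeriv ℝ k f (x + s • u) (fun _ => u))
      (iteratedFDeriv ℝ (k + 1) f (x + s • u) (fun _ => u)) s := by
  have h1 := (hf.differentiableAt_iteratedFDeriv hk).hasFDerivAt
  have h2 : HasDerivAt (fun s : ℝ => x + s • u) u s := by
    simpa using ((hasDerivAt_id s).smul_const u).const_add x
  have h3 := h1.comp_hasDerivAt s h2
  have h4 := ((ContinuousMultilinearMap.apply ℝ (fun _ : Fin k => E) ℝ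
    (fun _ => u)).hasFDerivAt).comp_hasDerivAt s h3
  exact h4

variable {p : ℕ} {f : EuclideanSpace ℝ (Fin p) → ℝ} {x : EuclideanSpace ℝ (Fin p)}
  {DV : Matrix (Fin p) (Fin p) ℝ}

lemma quadForm_DGsq (u : EuclideanSpace ℝ (Fin p)) :
    quadForm (DGsq f x) u = -iteratedFDeriv ℝ 2 f x (fun _ => u) := by
  have hu : u = ∑ i, u i • EuclideanSpace.single i (1 : ℝ) := by
    simpa using ((EuclideanSpace.basisFun (Fin p) ℝ).sum_repr u).symm
  have h1 : quadForm (DGsq f x) u = ∑ i, ∑ j, (DGsq f x) i j * u j * u i := by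
    simp only [quadForm, PiLp.inner_apply, Matrix.ofLp_toEuclideanCLM, Matrix.mulVec, dotProduct,
      RCLike.inner_apply, conj_trivial, Finset.mul_sum]
    refine Finset.sum_congr rfl fun i _ => Finset.sum_congr rfl fun j _ => by ring
  have h2 : iteratedFDeriv ℝ 2 f x (fun _ => u) = ∑ i, ∑ j,
      hessian f x i j * u j * u i := by
    rw [iteratedFDeriv_two_apply]
    conv_lhs => rw [hu]
    simp only [map_sum, map_smul, FunLike.coe_sum, Finset.sum_apply, FunLike.coe_smul,
      Pi.smul_apply, smul_eq_mul, Finset.mul_sum]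
    rw [Finset.sum_comm]
    refine Finset.sum_congr rfl fun i _ => Finset.sum_congr rfl fun j _ => ?_
    simp only [hessian, Matrix.of_apply, iteratedFDeriv_two_apply, Matrix.cons_val_zero,
      Matrix.cons_val_one]
    ring
  rw [h1, h2, ← Finset.sum_neg_distrib]
  refine Finset.sum_congr rfl fun i _ => ?_
  rw [← Finset.sum_neg_distrib]
  refine Finset.sum_congr rfl fun j _ => ?_
  simp only [DGsq, Matrix.neg_apply]
  ring

lemma normD_smul (s : ℝ) (u : EuclideanSpace ℝ (Fin p)) : normD DV (s • u) = |s| * normD DV u := by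
  simp [normD, norm_smul]

lemma normD_nonneg (u : EuclideanSpace ℝ (Fin p)) : 0 ≤ normD DV u := norm_nonneg _

lemma quadForm_smul (M : Matrix (Fin p) (Fin p) ℝ) (s : ℝ) (u : EuclideanSpace ℝ (Fin p)) :
    quadForm M (s • u) = s ^ 2 * quadForm M u := by
  simp only [quadForm, map_smul, inner_smul_left, inner_smul_right, conj_trivial]
  ring

/-- The remainder `f(x + u) - f(x) + ‖D_G u‖² / 2` of the quadratic expansion of `f` at a
maximum `x`. -/
noncomputable def taylorRem (f : EuclideanSpace ℝ (Fin p) → ℝ) (x u : EuclideanSpace ℝ (Fin p)) : ℝ :=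
  f (x + u) - f x + quadForm (DGsq f x) u / 2

lemma smul_mem_ball {R s : ℝ} {u : EuclideanSpace ℝ (Fin p)} (hu : normD DV u ≤ R)
    (hs : s ∈ Set.Icc (0 : ℝ) 1) : s • u ∈ {u | normD DV u ≤ R} := by
  have h : normD DV (s • u) ≤ normD DV u := by
    rw [normD_smul, abs_of_nonneg hs.1]
    exact mul_le_of_le_one_left (normD_nonneg u) hs.2
  exact h.trans hu

lemma iteratedFDeriv_one_eq_zero (hmax : IsMaxOn f Set.univ x) (u : EuclideanSpace ℝ (Fin p)) :
    iteratedFDeriv ℝ 1 f x (fun _ => u) = 0 := by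
  rw [iteratedFDeriv_one_apply, (hmax.isLocalMax Filter.univ_mem).fderiv_eq_zero]
  rfl

/-- Third order control of the remainder and of its radial derivative. -/
lemma CondS3.taylor {n c₃ R : ℝ} (h : CondS3 f x DV {u | normD DV u ≤ R} n c₃)
    (hmax : IsMaxOn f Set.univ x) {u : EuclideanSpace ℝ (Fin p)} (hu : normD DV u ≤ R) :
    |taylorRem f x u| ≤ c₃ * (√n)⁻¹ * normD DV u ^ 3 / 6 ∧
    ∃ D, HasDerivAt (fun s : ℝ => f (x + s • u)) D 1 ∧
      |D + quadForm (DGsq f x) u| ≤ c₃ * (√n)⁻¹ * normD DV u ^ 3 / 2 := by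
  have hd : ∀ s ∈ Set.Icc (0 : ℝ) 1, ∀ k : ℕ, k < 3 →
      HasDerivAt (fun s : ℝ => iteratedFDeriv ℝ k f (x + s • u) (fun _ => u))
      (iteratedFDeriv ℝ (k + 1) f (x + s • u) (fun _ => u)) s := fun s hs k hk =>
    hasDerivAt_iteratedFDeriv_line (h.smooth _ (smul_mem_ball hu hs)) (by exact_mod_cast hk)
  obtain ⟨t0, t1⟩ := taylor_three (fun s hs => hd s hs 0 (by norm_num))
    (fun s hs => hd s hs 1 (by norm_num)) (fun s hs => hd s hs 2 (by norm_num)) (h.bound u hu)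
  have hq := quadForm_DGsq (f := f) (x := x) u
  have h1 := iteratedFDeriv_one_eq_zero hmax u
  simp only [iteratedFDeriv_zero_apply, one_smul, zero_smul, add_zero,
    Nat.reduceAdd, h1, sub_zero] at t0 t1
  refine ⟨?_, _, by simpa using hd 1 (by simp) 0 (by norm_num), ?_⟩
  · convert t0 using 2
    rw [taylorRem, hq]
    ring
  · convert t1 using 2
    rw [hq, iteratedFDeriv_one_apply]
    ring

/-- Under the fourth order condition the even part of the remainder is of fourth order. -/
lemma CondS4.taylor {n c₄ R : ℝ} (h : CondS4 f x DV {u | normD DV u ≤ R} n c₄)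
    (hmax : IsMaxOn f Set.univ x) {u : EuclideanSpace ℝ (Fin p)} (hu : normD DV u ≤ R) :
    |(taylorRem f x u + taylorRem f x (-u)) / 2| ≤ c₄ * n⁻¹ * normD DV u ^ 4 / 24 := by
  have key : ∀ v : EuclideanSpace ℝ (Fin p), normD DV v ≤ R →
      |taylorRem f x v - iteratedFDeriv ℝ 3 f x (fun _ => v) / 6| ≤
        c₄ * n⁻¹ * normD DV v ^ 4 / 24 := by
    intro v hv
    have hd : ∀ s ∈ Set.Icc (0 : ℝ) 1, ∀ k : ℕ, k < 4 →
        HasDerivAt (fun s : ℝ => iteratedFDeriv ℝ k f (x + s • v) (fun _ => v))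
        (iteratedFDeriv ℝ (k + 1) f (x + s • v) (fun _ => v)) s := fun s hs k hk =>
      hasDerivAt_iteratedFDeriv_line (h.smooth _ (smul_mem_ball hv hs)) (by exact_mod_cast hk)
    have t0 := taylor_four (fun s hs => hd s hs 0 (by norm_num))
      (fun s hs => hd s hs 1 (by norm_num)) (fun s hs => hd s hs 2 (by norm_num))
      (fun s hs => hd s hs 3 (by norm_num)) (h.bound v hv)
    have hq := quadForm_DGsq (f := f) (x := x) v
    have h1 := iteratedFDeriv_one_eq_zero hmax v
    simp only [iteratedFDeriv_zero_apply, one_smul, zero_smul, add_zero,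
      Nat.reduceAdd, h1, sub_zero] at t0
    convert t0 using 2
    rw [taylorRem, hq]
    ring
  have hneg : normD DV (-u) = normD DV u := by simp [normD]
  have k1 := key u hu
  have k2 := key (-u) (by rwa [hneg])
  have h3 : iteratedFDeriv ℝ 3 f x (fun _ => -u) = -iteratedFDeriv ℝ 3 f x (fun _ => u) := by
    have := (iteratedFDeriv ℝ 3 f x).map_smul_univ (fun _ => (-1 : ℝ)) (fun _ => u)
    simpa [pow_succ] using this
  rw [h3, hneg] at k2
  obtain ⟨a1, a2⟩ := abs_le.1 k1
  obtain ⟨b1, b2⟩ := abs_le.1 k2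
  rw [abs_le]
  constructor <;> linarith

/-- Outside the ball of radius `ρ` the concave function `ell` lies below its tangent along the ray
at radius `ρ`, which is controlled by the third order condition. -/
lemma taylorRem_le_of_concave {n c₃ R ρ : ℝ} (hC : ConcaveOn ℝ Set.univ (ell f x DV))
    (h : CondS3 f x DV {u | normD DV u ≤ R} n c₃) (hmax : IsMaxOn f Set.univ x) (hρ : 0 < ρ)
    (hρR : ρ ≤ R) (hτ : c₃ * (√n)⁻¹ * ρ ≤ 1) {u : EuclideanSpace ℝ (Fin p)}
    (hu : ρ < normD DV u) :
    taylorRem f x u ≤ normD DV u ^ 2 / 2 - ρ * normD DV u / 2 + ρ ^ 2 / 6 := by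
  set Z := normD DV u with hZ
  have hZ0 : 0 < Z := hρ.trans hu
  set v := (ρ / Z) • u with hv
  have huv : u = (Z / ρ) • v := by
    rw [hv, smul_smul, div_mul_div_cancel₀ hρ.ne', div_self hZ0.ne', one_smul]
  have hvn : normD DV v = ρ := by
    rw [hv, normD_smul, abs_of_pos (by positivity), ← hZ]
    field_simp
  obtain ⟨t0, D, hD, t1⟩ := h.taylor hmax (u := v) (by rw [hvn]; exact hρR)
  rw [hvn] at t0 t1
  set φ : ℝ → ℝ := fun s => ell f x DV (s • v) with hφ
  have hφc : ConcaveOn ℝ Set.univ φ := by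
    have := hC.comp_linearMap (LinearMap.toSpanSingleton ℝ _ v)
    simpa [Function.comp_def] using this
  have hφe : ∀ s, φ s = f (x + s • v) + s ^ 2 * quadForm (DGsq f x) v / 2 - s ^ 2 * ρ ^ 2 / 2 := by
    intro s
    simp only [hφ, ell, quadForm_smul, normD_smul, hvn, mul_pow, sq_abs]
  have hφd : HasDerivAt φ (D + quadForm (DGsq f x) v - ρ ^ 2) 1 := by
    have e : φ = fun s => f (x + s • v) + s ^ 2 * quadForm (DGsq f x) v / 2 - s ^ 2 * ρ ^ 2 / 2 :=
      funext hφe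
    rw [e]
    convert! (hD.add (((hasDerivAt_pow 2 (1 : ℝ)).mul_const (quadForm (DGsq f x) v)).div_const
      2)).sub (((hasDerivAt_pow 2 (1 : ℝ)).mul_const (ρ ^ 2)).div_const 2) using 1
    norm_num
  have h1s : 1 < Z / ρ := (one_lt_div hρ).2 hu
  have hslope := hφc.slope_le_of_hasDerivAt (Set.mem_univ 1) (Set.mem_univ (Z / ρ)) h1s hφd
  rw [slope_def_field, div_le_iff₀ (by linarith), hφe, hφe, ← huv, one_smul] at hslope
  have hcube : c₃ * (√n)⁻¹ * ρ ^ 3 ≤ ρ ^ 2 := by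
    calc _ = c₃ * (√n)⁻¹ * ρ * ρ ^ 2 := by ring
      _ ≤ 1 * ρ ^ 2 := by gcongr
      _ = _ := one_mul _
  have q1 := (abs_le.1 t0).2
  have q2 := (abs_le.1 t1).2
  have hslope2 : (D + quadForm (DGsq f x) v - ρ ^ 2) * (Z / ρ - 1) ≤ -(ρ ^ 2 / 2) * (Z / ρ - 1) :=
    mul_le_mul_of_nonneg_right (by linarith) (by linarith)
  have e1 : quadForm (DGsq f x) u = (Z / ρ) ^ 2 * quadForm (DGsq f x) v := by
    rw [← quadForm_smul, ← huv]
  have e2 : (Z / ρ) ^ 2 * ρ ^ 2 = Z ^ 2 := by field_simp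
  have e3 : -(ρ ^ 2 / 2) * (Z / ρ - 1) = -(ρ * Z / 2) + ρ ^ 2 / 2 := by
    field_simp
    ring
  rw [e3] at hslope2
  rw [e2, ← e1] at hslope
  simp only [taylorRem] at q1 ⊢
  linarith

end Taylor

/-! ### Whitened coordinates -/

section Whitening

variable {p : ℕ}

lemma toEuclideanCLM_inner_left {A : Matrix (Fin p) (Fin p) ℝ} (hA : A.IsHermitian)
    (v w : EuclideanSpace ℝ (Fin p)) :
    inner ℝ (Matrix.toEuclideanCLM (𝕜 := ℝ) A v) w =
      inner ℝ v (Matrix.toEuclideanCLM (𝕜 := ℝ) A w) := by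
  have h : ContinuousLinearMap.adjoint (Matrix.toEuclideanCLM (𝕜 := ℝ) A) =
      Matrix.toEuclideanCLM (𝕜 := ℝ) A := by
    rw [← ContinuousLinearMap.star_eq_adjoint, ← map_star, Matrix.star_eq_conjTranspose, hA.eq]
  rw [← ContinuousLinearMap.adjoint_inner_right, h]

lemma quadForm_nonneg {A : Matrix (Fin p) (Fin p) ℝ} (hA : A.PosSemidef)
    (u : EuclideanSpace ℝ (Fin p)) : 0 ≤ quadForm A u := by
  rw [quadForm, real_inner_comm, Matrix.inner_toEuclideanCLM]
  simpa using hA.dotProduct_mulVec_nonneg u.ofLp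

lemma normD_sq_le_quadForm {M D : Matrix (Fin p) (Fin p) ℝ} (hD : D.PosSemidef)
    (hM : (M - D * D).PosSemidef) (u : EuclideanSpace ℝ (Fin p)) :
    normD D u ^ 2 ≤ quadForm M u := by
  have h1 := quadForm_nonneg hM u
  have h2 : quadForm (M - D * D) u = quadForm M u - normD D u ^ 2 := by
    rw [normD, ← real_inner_self_eq_norm_sq, toEuclideanCLM_inner_left hD.isHermitian]
    simp only [quadForm, map_sub, map_mul, sub_apply, inner_sub_left, mul_apply_eq_comp]
    rw [real_inner_comm u, real_inner_comm u]
  linarith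

open scoped MatrixOrder in
/-- The square root of the covariance `M⁻¹` maps the standard Gaussian vector to one with
precision `M`; in these coordinates the quadratic form of `M` is the square norm, and that of
`D²` has trace `tr (D² M⁻¹)`. -/
lemma exists_whitening {M D : Matrix (Fin p) (Fin p) ℝ} (hM : M.PosDef) (hD : D.PosSemidef) :
    ∃ e : EuclideanSpace ℝ (Fin p) ≃L[ℝ] EuclideanSpace ℝ (Fin p),
      (∀ x, multivariateGaussian x M⁻¹ =
        (stdGaussian (EuclideanSpace ℝ (Fin p))).map fun w => x + e w) ∧
      (∀ w, quadForm M (e w) = ‖w‖ ^ 2) ∧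
      ∃ B : Matrix (Fin p) (Fin p) ℝ, (B.transpose * B).trace = (D * D * M⁻¹).trace ∧
        ∀ w, normD D (e w) = ‖Matrix.toEuclideanCLM (𝕜 := ℝ) B w‖ := by
  set S := CFC.sqrt M⁻¹ with hS
  have hSS : S * S = M⁻¹ := CFC.sqrt_mul_sqrt_self _ hM.inv.posSemidef.nonneg
  have hSsa : S.IsHermitian := (CFC.sqrt_nonneg M⁻¹).isSelfAdjoint
  have hdet : IsUnit M.det := (Matrix.isUnit_iff_isUnit_det M).1 hM.isUnit
  have h1 : S * (S * M) = 1 := by rw [← mul_assoc, hSS, Matrix.nonsing_inv_mul _ hdet]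
  have h2 : S * M * S = 1 := mul_eq_one_comm.1 h1
  set L := Matrix.toEuclideanCLM (𝕜 := ℝ) S with hL
  set L' := Matrix.toEuclideanCLM (𝕜 := ℝ) (S * M) with hL'
  have i1 : ∀ w, L' (L w) = w := fun w => by
    rw [← mul_apply_eq_comp, hL, hL', ← map_mul, h2, map_one]
    rfl
  have i2 : ∀ w, L (L' w) = w := fun w => by
    rw [← mul_apply_eq_comp, hL, hL', ← map_mul, h1, map_one]
    rfl
  refine ⟨ContinuousLinearEquiv.equivOfInverse L L' i1 i2, fun x => rfl, fun w => ?_,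
    D * S, ?_, fun w => ?_⟩
  · change quadForm M (L w) = ‖w‖ ^ 2
    rw [quadForm, real_inner_comm, hL, toEuclideanCLM_inner_left hSsa, ← mul_apply_eq_comp,
      ← mul_apply_eq_comp, ← map_mul, ← map_mul, h2, map_one, one_apply_eq_self,
      real_inner_self_eq_norm_sq]
  · have hDt : D.transpose = D := by simpa using hD.isHermitian.eq
    have hSt : S.transpose = S := by simpa using hSsa.eq
    rw [Matrix.transpose_mul, hDt, hSt, mul_assoc, Matrix.trace_mul_comm, mul_assoc, mul_assoc,
      hSS, mul_assoc]
  · change ‖Matrix.toEuclideanCLM (𝕜 := ℝ) D (L w)‖ = _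
    rw [map_mul, mul_apply_eq_comp]

lemma tilted_add_const {α : Type*} [MeasurableSpace α] (μ : Measure α) (f : α → ℝ) (c : ℝ) :
    μ.tilted (fun x => f x + c) = μ.tilted f := by
  simp only [Measure.tilted, Real.exp_add, integral_mul_const]
  congr 1
  ext x
  rw [mul_div_mul_right _ _ (Real.exp_pos c).ne']

/-- In whitened coordinates centered at `x`, the measure `P_f` is the standard Gaussian measure
tilted by the remainder of the quadratic expansion of `f`. -/
lemma Pf_eq_map_tilted {f : EuclideanSpace ℝ (Fin p) → ℝ} {x : EuclideanSpace ℝ (Fin p)}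
    (e : EuclideanSpace ℝ (Fin p) ≃L[ℝ] EuclideanSpace ℝ (Fin p))
    (he : ∀ w, quadForm (DGsq f x) (e w) = ‖w‖ ^ 2) :
    Pf f = ((stdGaussian (EuclideanSpace ℝ (Fin p))).tilted fun w => taylorRem f x (e w)).map
      (fun w => x + e w) ∧
    (Integrable (fun w => Real.exp (taylorRem f x (e w)))
      (stdGaussian (EuclideanSpace ℝ (Fin p))) → Integrable fun y => Real.exp (f y)) := by
  set Ψ := (e.toHomeomorph.trans (Homeomorph.addLeft x)).toMeasurableEquiv with hΨ
  have hΨe : ∀ w, Ψ w = x + e w := fun w => rfl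
  have hdet : LinearMap.det (e.toLinearEquiv : EuclideanSpace ℝ (Fin p) →ₗ[ℝ] _) ≠ 0 :=
    (LinearEquiv.isUnit_det' e.toLinearEquiv).ne_zero
  obtain ⟨c, hc, hc', hmap⟩ : ∃ c : ENNReal, c ≠ 0 ∧ c ≠ ⊤ ∧
      (volume : Measure (EuclideanSpace ℝ (Fin p))).map Ψ = c • volume := by
    refine ⟨ENNReal.ofReal |(LinearMap.det (e.toLinearEquiv : EuclideanSpace ℝ (Fin p) →ₗ[ℝ] _))⁻¹|,
      ?_, ENNReal.ofReal_ne_top, ?_⟩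
    · simpa using hdet
    · have h1 : (Ψ : EuclideanSpace ℝ (Fin p) → EuclideanSpace ℝ (Fin p)) =
          (fun y => x + y) ∘ (e.toLinearEquiv : EuclideanSpace ℝ (Fin p) →ₗ[ℝ] _) := rfl
      have h2 : Measurable
          (e.toLinearEquiv : EuclideanSpace ℝ (Fin p) →ₗ[ℝ] EuclideanSpace ℝ (Fin p)) :=
        e.continuous.measurable
      rw [h1, ← Measure.map_map (by fun_prop) h2,
        Measure.map_linearMap_addHaar_eq_smul_addHaar _ hdet, Measure.map_smul,
        (measurePreserving_add_left volume x).map_eq]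
  have hexp : ∀ w, -(‖w‖ ^ 2 / 2) + taylorRem f x (e w) = f (Ψ w) + -f x := by
    intro w
    rw [taylorRem, he, hΨe]
    ring
  constructor
  · have h1 : Pf f = ((volume : Measure (EuclideanSpace ℝ (Fin p))).tilted (f ∘ Ψ)).map Ψ := by
      rw [← tilted_map_equiv, hmap, tilted_smul_measure _ _ hc hc']
      rfl
    rw [h1, stdGaussian_eq_tilted, tilted_tilted integrable_exp_neg_norm_sq]
    have h2 : ((fun w : EuclideanSpace ℝ (Fin p) => -(‖w‖ ^ 2 / 2)) +
        fun w => taylorRem f x (e w)) = fun w => (f ∘ Ψ) w + -f x := funext hexp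
    rw [h2, tilted_add_const]
    rfl
  · intro hi
    rw [stdGaussian_eq_tilted, integrable_tilted_iff integrable_exp_neg_norm_sq] at hi
    have h2 : Integrable ((fun y => Real.exp (f y)) ∘ Ψ) := by
      refine (hi.mul_const (Real.exp (f x))).congr (Filter.Eventually.of_forall fun w => ?_)
      simp only [smul_eq_mul, Function.comp]
      rw [← Real.exp_add, hexp, ← Real.exp_add, neg_add_cancel_right]
    rw [← integrable_map_equiv, hmap, integrable_smul_measure hc hc'] at h2
    exact h2

end Whitening

/-! ### Total variation and symmetric sets -/

section Assembly

variable {p : ℕ}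

lemma tilted_real_apply {α : Type*} [MeasurableSpace α] (μ : Measure α) (g : α → ℝ) {A : Set α}
    (hA : MeasurableSet A) :
    (μ.tilted g).real A = (∫ w in A, Real.exp (g w) ∂μ) / ∫ w, Real.exp (g w) ∂μ := by
  rw [measureReal_def, tilted_apply_eq_ofReal_integral' _ hA, integral_div, ENNReal.toReal_ofReal]
  exact div_nonneg (integral_nonneg fun _ => (Real.exp_pos _).le)
    (integral_nonneg fun _ => (Real.exp_pos _).le)

lemma supDist_le {E : Type*} [MeasurableSpace E] {𝒜 : Set (Set E)} (h𝒜 : 𝒜.Nonempty)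
    {μ ν : Measure E} {C : ℝ} (h : ∀ A ∈ 𝒜, |μ.real A - ν.real A| ≤ C) : supDist 𝒜 μ ν ≤ C := by
  have := h𝒜.to_subtype
  exact ciSup_le fun A => h A A.2

lemma abs_real_sub_real_le_one {E : Type*} [MeasurableSpace E] (μ ν : Measure E)
    [IsProbabilityMeasure μ] [IsProbabilityMeasure ν] (A : Set E) :
    |μ.real A - ν.real A| ≤ 1 := by
  have h1 : μ.real A ≤ 1 := measureReal_le_one
  have h2 : ν.real A ≤ 1 := measureReal_le_one
  have h3 : 0 ≤ μ.real A := measureReal_nonneg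
  have h4 : 0 ≤ ν.real A := measureReal_nonneg
  rw [abs_le]
  constructor <;> linarith

/-- The standard Gaussian measure is invariant under `w ↦ -w`, so that on symmetric sets a density
may be replaced by its symmetrization. -/
lemma setIntegral_stdGaussian_symm {F : EuclideanSpace ℝ (Fin p) → ℝ}
    (hF : Integrable F (stdGaussian (EuclideanSpace ℝ (Fin p))))
    {A : Set (EuclideanSpace ℝ (Fin p))} (hA : ∀ w, w ∈ A ↔ -w ∈ A) :
    Integrable (fun w => F (-w)) (stdGaussian (EuclideanSpace ℝ (Fin p))) ∧
    ∫ w in A, F w ∂(stdGaussian (EuclideanSpace ℝ (Fin p))) =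
      ∫ w in A, (F w + F (-w)) / 2 ∂(stdGaussian (EuclideanSpace ℝ (Fin p))) := by
  have hmp : MeasurePreserving (Neg.neg : EuclideanSpace ℝ (Fin p) → _)
      (stdGaussian (EuclideanSpace ℝ (Fin p))) (stdGaussian (EuclideanSpace ℝ (Fin p))) :=
    ⟨measurable_neg, stdGaussian_map (LinearIsometryEquiv.neg ℝ)⟩
  have hemb : MeasurableEmbedding (Neg.neg : EuclideanSpace ℝ (Fin p) → _) :=
    (MeasurableEquiv.neg _).measurableEmbedding
  have hi : Integrable (fun w => F (-w)) (stdGaussian (EuclideanSpace ℝ (Fin p))) :=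
    (hmp.integrable_comp_emb hemb).2 hF
  refine ⟨hi, ?_⟩
  have h1 := hmp.setIntegral_preimage_emb hemb F A
  have h2 : (Neg.neg : EuclideanSpace ℝ (Fin p) → _) ⁻¹' A = A := by
    ext w
    exact (hA w).symm
  rw [h2] at h1
  rw [integral_div, integral_add hF.integrableOn hi.integrableOn, h1]
  ring

end Assembly

end LaplaceApprox

open LaplaceApprox

theorem mainTheorem2 {p : ℕ} (f : EuclideanSpace ℝ (Fin p) → ℝ)
    (xs : EuclideanSpace ℝ (Fin p)) (hmax : IsMaxOn f Set.univ xs)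
    (hpd : (LaplaceApprox.DGsq f xs).PosDef)
    (DV : Matrix (Fin p) (Fin p) ℝ) (hC0 : LaplaceApprox.CondC0 f xs DV)
    (ν t n c₃ : ℝ) (hν0 : 0 < ν) (hν1 : ν ≤ 3 / 4) (ht : 0 < t) (hn : 0 < n) (hc₃ : 0 ≤ c₃)
    (hS3 : LaplaceApprox.CondS3 f xs DV (LaplaceApprox.localSet f xs DV ν t) n c₃)
    (hsmall : c₃ * LaplaceApprox.radius f xs DV t * (√n)⁻¹ ≤ 3 / 4) :
    Integrable (fun y => Real.exp (f y)) ∧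
    LaplaceApprox.tvDist (LaplaceApprox.Pf f)
        (multivariateGaussian xs (LaplaceApprox.DGsq f xs)⁻¹) ≤
      2 * c₃ * √((LaplaceApprox.effDim f xs DV + 1) ^ 3 / n) + 4 * Real.exp (-t) ∧
    ∀ c₄ : ℝ, 0 ≤ c₄ →
      LaplaceApprox.CondS4 f xs DV (LaplaceApprox.localSet f xs DV ν t) n c₄ →
      LaplaceApprox.supDist (LaplaceApprox.symmSets (EuclideanSpace ℝ (Fin p)))
          ((LaplaceApprox.Pf f).map (fun y => y - xs))
          (multivariateGaussian 0 (LaplaceApprox.DGsq f xs)⁻¹) ≤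
        4 / 9 * (c₃ ^ 2 * (LaplaceApprox.effDim f xs DV + 2) ^ 3 / n
          + 2 * c₄ * (LaplaceApprox.effDim f xs DV + 1) ^ 2 / n) + 4 * Real.exp (-t) := by
  obtain ⟨e, hgauss, hquad, B, htr, hB⟩ := exists_whitening hpd hC0.posSemidef
  obtain ⟨lam, hlam, hY⟩ := exists_isChiSqMixture B fun w => by
    rw [← hB]
    have := normD_sq_le_quadForm hC0.posSemidef hC0.le_DGsq (e w)
    rw [hquad] at this
    exact le_of_sq_le_sq this (norm_nonneg w)
  have hlam' : ∑ i, lam i = effDim f xs DV := hlam.trans htr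
  obtain ⟨hPf, hint⟩ := Pf_eq_map_tilted e hquad
  have hq0 : 0 ≤ effDim f xs DV := hlam' ▸ Finset.sum_nonneg fun i _ => hY.weight_nonneg i
  set q := effDim f xs DV with hqdef
  set γ := stdGaussian (EuclideanSpace ℝ (Fin p)) with hγ
  set F : EuclideanSpace ℝ (Fin p) → ℝ := fun w => Real.exp (taylorRem f xs (e w)) with hF
  have hsqrt : ∀ w, √(‖Matrix.toEuclideanCLM (𝕜 := ℝ) B w‖ ^ 2) = normD DV (e w) := fun w => by
    rw [Real.sqrt_sq (norm_nonneg _), hB]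
  have hb : 0 < √(2 * t) := Real.sqrt_pos.2 (by linarith)
  have ha := Real.sqrt_nonneg q
  have hr : radius f xs DV t = 2 * √q + √(2 * t) := rfl
  -- the ball of radius `ρ` is contained in the local set since `ν ≤ 3 / 4`
  set ρ := 4 / 3 * (2 * √q + √(2 * t)) with hρ
  have hρ0 : 0 < ρ := by positivity
  have hρR : ρ ≤ ν⁻¹ * radius f xs DV t := by
    rw [hr, hρ]
    refine mul_le_mul_of_nonneg_right ?_ (by positivity)
    rw [le_inv_comm₀ (by norm_num) hν0]
    linarith
  have hτ0 : 0 ≤ c₃ * (√n)⁻¹ := by positivity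
  have hτρ : c₃ * (√n)⁻¹ * ρ ≤ 1 := by
    rw [hr] at hsmall
    rw [hρ]
    linarith
  have hin3 : ∀ w, normD DV (e w) ≤ ρ →
      |taylorRem f xs (e w)| ≤ c₃ * (√n)⁻¹ * normD DV (e w) ^ 3 / 6 := fun w hw =>
    (CondS3.taylor hS3 hmax (hw.trans hρR)).1
  have hout3 : ∀ w, ρ < normD DV (e w) → F w ≤
      Real.exp (normD DV (e w) ^ 2 / 2 - ρ * normD DV (e w) / 2 + ρ ^ 2 / 6) := fun w hw =>
    Real.exp_le_exp.2 (taylorRem_le_of_concave hC0.concave hS3 hmax hρ0 hρR hτρ hw)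
  -- `f` is a finite concave function up to a quadratic one, hence continuous
  have hcont : Continuous f := by
    have h1 := hC0.concave.continuousOn isOpen_univ
    rw [continuousOn_univ] at h1
    have h2 : Continuous fun u => quadForm (DGsq f xs) u := by
      unfold quadForm
      fun_prop
    have h3 : Continuous fun u => normD DV u := by
      unfold normD
      fun_prop
    have h4 : Continuous fun u => ell f xs DV u - quadForm (DGsq f xs) u / 2 + normD DV u ^ 2 / 2 := by
      fun_prop
    have h5 : f = fun y => (fun u => ell f xs DV u - quadForm (DGsq f xs) u / 2 +
        normD DV u ^ 2 / 2) (y - xs) := by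
      ext y
      simp only [ell, add_sub_cancel]
      ring
    rw [h5]
    exact h4.comp (by fun_prop)
  have hFcont : Continuous F := by
    simp only [hF, taylorRem, hquad]
    fun_prop
  have hF0 : ∀ w, 0 ≤ F w := fun w => (Real.exp_pos _).le
  have hρ2 : √q < ρ / 2 := by rw [hρ]; linarith
  have hout' : ∀ w, ρ < √(‖Matrix.toEuclideanCLM (𝕜 := ℝ) B w‖ ^ 2) →
      F w ≤ Real.exp (‖Matrix.toEuclideanCLM (𝕜 := ℝ) B w‖ ^ 2 / 2 -
        ρ * √(‖Matrix.toEuclideanCLM (𝕜 := ℝ) B w‖ ^ 2) / 2 + ρ ^ 2 / 6) := by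
    intro w hw
    rw [hsqrt] at hw ⊢
    rw [← hB]
    exact hout3 w hw
  have hFi : Integrable F γ := by
    refine hY.integrable_density hlam' hρ2 hFcont.measurable hF0
      (K := Real.exp (c₃ * (√n)⁻¹ * ρ ^ 3 / 6)) (fun w hw => ?_) hout'
    rw [hsqrt] at hw
    refine Real.exp_le_exp.2 ((le_abs_self _).trans ((hin3 w hw).trans ?_))
    have := pow_le_pow_left₀ (normD_nonneg (e w)) hw 3
    gcongr
  have hFpos : 0 < ∫ w, F w ∂γ := integral_exp_pos hFi
  have hPt : IsProbabilityMeasure (γ.tilted fun w => taylorRem f xs (e w)) :=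
    isProbabilityMeasure_tilted hFi
  refine ⟨hint hFi, ?_, fun c₄ hc₄ hS4 => ?_⟩
  · have hbound : 2 * c₃ * √((q + 1) ^ 3 / n) = 2 * (c₃ * (√n)⁻¹ * √(q + 1) ^ 3) := by
      have hcube : (q + 1) ^ 3 = (√(q + 1) ^ 3) ^ 2 := by
        rw [← pow_mul, mul_comm 3 2, pow_mul, Real.sq_sqrt (by linarith)]
      rw [Real.sqrt_div (by positivity), hcube, Real.sqrt_sq (by positivity)]
      ring
    rw [hbound]
    refine supDist_le ⟨∅, MeasurableSet.empty⟩ fun A hA => ?_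
    have hΨ : Measurable fun w => xs + e w := by fun_prop
    rw [hgauss, hPf, map_measureReal_apply hΨ hA, map_measureReal_apply hΨ hA]
    have hA' := hΨ hA
    set A' := (fun w => xs + e w) ⁻¹' A with hA'def
    -- the smallness of `τ (p_G + 1)^{3/2}` and of `exp (-t)` may be assumed
    by_cases htriv : 1 ≤ 2 * (c₃ * (√n)⁻¹ * √(q + 1) ^ 3) + 4 * Real.exp (-t)
    · exact (abs_real_sub_real_le_one _ _ _).trans htriv
    · rw [not_le] at htriv
      have hnn : 0 ≤ 2 * (c₃ * (√n)⁻¹ * √(q + 1) ^ 3) := by positivity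
      have hep := Real.exp_pos (-t)
      obtain ⟨H, hHi, hH0, hHC, hHle⟩ := hY.exists_majorant_tv hlam' hτ0 hτρ (by linarith)
      rw [tilted_real_apply _ _ hA']
      refine hY.abs_setIntegral_div_sub_le hlam' ht (by linarith) hρ hFi hF0 hFpos hHi hH0 hHC
        (fun w hw => hHle w hw _ ?_) hout' hA'
      rw [hsqrt] at hw ⊢
      exact hin3 w hw
  · have hbound : 4 / 9 * (c₃ ^ 2 * (q + 2) ^ 3 / n + 2 * c₄ * (q + 1) ^ 2 / n) =
        4 / 9 * ((c₃ * (√n)⁻¹) ^ 2 * (q + 2) ^ 3 + 2 * (c₄ * n⁻¹ * (q + 1) ^ 2)) := by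
      rw [mul_pow, inv_pow, Real.sq_sqrt hn.le]
      ring
    rw [hbound]
    have hne : (symmSets (EuclideanSpace ℝ (Fin p))).Nonempty := ⟨∅, MeasurableSet.empty, by simp⟩
    refine supDist_le hne fun A hA => ?_
    obtain ⟨hAm, hAs⟩ := hA
    have hΨ : Measurable fun w => xs + e w := by fun_prop
    have hΨ' : Measurable fun w => (0 : EuclideanSpace ℝ (Fin p)) + e w := by fun_prop
    have hcomp : (fun y => y - xs) ∘ (fun w => xs + e w) =
        fun w => (0 : EuclideanSpace ℝ (Fin p)) + e w := by
      ext w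
      simp
    rw [hgauss, hPf, Measure.map_map (by fun_prop) hΨ, hcomp, map_measureReal_apply hΨ' hAm,
      map_measureReal_apply hΨ' hAm]
    have hA' := hΨ' hAm
    set A' := (fun w => (0 : EuclideanSpace ℝ (Fin p)) + e w) ⁻¹' A with hA'def
    have hA's : ∀ w, w ∈ A' ↔ -w ∈ A' := fun w => by
      simp only [hA'def, Set.mem_preimage, zero_add, map_neg]
      exact hAs _
    by_cases htriv : 1 ≤ 4 / 9 * ((c₃ * (√n)⁻¹) ^ 2 * (q + 2) ^ 3 +
        2 * (c₄ * n⁻¹ * (q + 1) ^ 2)) + 4 * Real.exp (-t)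
    · exact (abs_real_sub_real_le_one _ _ _).trans htriv
    · rw [not_le] at htriv
      have hnn : 0 ≤ (c₃ * (√n)⁻¹) ^ 2 * (q + 2) ^ 3 := by positivity
      have hnn' : 0 ≤ 2 * (c₄ * n⁻¹ * (q + 1) ^ 2) := by positivity
      have hep := Real.exp_pos (-t)
      obtain ⟨H, hHi, hH0, hHC, hHle⟩ := hY.exists_majorant_symm (σ := c₄ * n⁻¹) hlam' hτ0
        (by positivity) hτρ (by linarith)
      have hneg : ∀ w, normD DV (e (-w)) = normD DV (e w) := fun w => by simp [normD]
      obtain ⟨hFi', hsymA⟩ := setIntegral_stdGaussian_symm hFi hA's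
      have hsym := (setIntegral_stdGaussian_symm hFi (A := Set.univ) (by simp)).2
      rw [setIntegral_univ, setIntegral_univ] at hsym
      rw [tilted_real_apply _ _ hA']
      change |(∫ w in A', F w ∂γ) / (∫ w, F w ∂γ) - γ.real A'| ≤ _
      have hsymi : Integrable (fun w => (F w + F (-w)) / 2) γ := (hFi.add hFi').div_const 2
      rw [hsymA, hsym]
      refine hY.abs_setIntegral_div_sub_le hlam' ht (by linarith) hρ hsymi
        (fun w => by linarith [hF0 w, hF0 (-w)]) (by rwa [← hsym]) hHi hH0 hHC
        (fun w hw => hHle w hw _ _ ?_ ?_ ?_) (fun w hw => ?_) hA'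
      · rw [hsqrt] at hw ⊢
        exact hin3 w hw
      · rw [hsqrt] at hw ⊢
        rw [← hneg]
        exact hin3 (-w) (by rwa [hneg])
      · rw [hsqrt] at hw ⊢
        rw [map_neg]
        exact CondS4.taylor hS4 hmax (hw.trans hρR)
      · have h1 := hout' w hw
        have h2 := hout' (-w) (by rwa [hsqrt, hneg, ← hsqrt])
        rw [map_neg, norm_neg] at h2
        linarith
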